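/- Let $\mu>-\tfrac12$ be real. Let $\Phi(a,c,z)=\sum_{n\ge 0}\frac{(a)_n}{(c)_n}\frac{z^n}{n!}$ be Kummer's confluent hypergeometric function, where $(a)_n=a(a+1)\cdots(a+n-1)$, and put $\mathbf e_\mu(z)=e^{z}\,\Phi(\mu,2\mu+1,-2z)$ for $z\in\mathbb C$. Let $L^2_\mu(\mathbb R)$ be the complex Hilbert space $L^2(\mathbb R,|t|^{2\mu}dt)$. For $a>0$ let $\mathfrak S_a$ be the complex linear span of the functions $t\mapsto e^{-at^2}t^n$, $n=0,1,2,\dots$. For $m\ge 0$ define $$\gamma_\mu(2m)=\frac{2^{2m}m!\,\Gamma(m+\mu+\frac12)}{\Gamma(\mu+\frac12)},\qquad \gamma_\mu(2m+1)=\frac{2^{2m+1}m!\,\Gamma(m+\mu+\frac32)}{\Gamma(\mu+\frac12)},$$ the generalized Hermite polynomials $$H^\mu_{2m}(x)=(-1)^m\frac{(2m)!}{m!}\sum_{k=0}^m(-1)^k\binom mk\frac{\Gamma(\mu+\frac12)}{\Gamma(k+\mu+\frac12)}x^{2k},$$ $$H^\mu_{2m+1}(x)=(-1)^m\frac{(2m+1)!}{m!}\sum_{k=0}^m(-1)^k\binom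 mk\frac{\Gamma(\mu+\frac12)}{\Gamma(k+\mu+\frac32)}x^{2k+1},$$ and the generalized Hermite functions $$\phi^\mu_n(x)=\Big(\frac{\gamma_\mu(n)}{\Gamma(\mu+\frac12)}\Big)^{1/2}\frac{1}{2^{n/2}\,n!}\,e^{-x^2/2}H^\mu_n(x),\qquad n\ge 0.$$ **Theorem.** For every $a>0$ one has $\mathfrak S_a\subset L^2_\mu(\mathbb R)$, and for all $f\in\mathfrak S_a$ and $x\in\mathbb R$ the functions $t\mapsto \mathbf e_\mu(\mp ixt)f(t)|t|^{2\mu}$ are integrable. There is a unitary operator $\mathcal F_\mu$ of $L^2_\mu(\mathbb R)$ onto itself such that, for all $a>0$ and $f\in\mathfrak S_a$, $$\mathcal F_\mu f(x)=\frac{1}{2^{\mu+\frac12}\Gamma(\mu+\frac12)}\int_{-\infty}^{\infty}\mathbf e_\mu(-ixt)f(t)|t|^{2\mu}\,dt\quad\text{for almost every }x,$$ and, for each single $a>0$, it is the only bounded linear operator on $L^2_\mu(\mathbb R)$ that satisfies this formula on $\mathfrak S_a$. The eigenvalues of $\mathcal F_\mu$ are exactly $1,-1,i,-i$. The functions $\phi^\mu_n$,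 $n\ge 0$, belong to $L^2_\mu(\mathbb R)$ and form a complete orthonormal set of eigenvectors of $\mathcal F_\mu$, with $\mathcal F_\mu\phi^\mu_n=(-i)^n\phi^\mu_n$. The inverse $\mathcal F_\mu^{-1}=\mathcal F_\mu^*$ satisfies, for all $a>0$ and $f\in\mathfrak S_a$, $$\mathcal F_\mu^{-1}f(x)=\frac{1}{2^{\mu+\frac12}\Gamma(\mu+\frac12)}\int_{-\infty}^{\infty}\mathbf e_\mu(ixt)f(t)|t|^{2\mu}\,dt\quad\text{for almost every }x.$$ -/

import Mathlib

open MeasureTheory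
open scoped ENNReal Nat

noncomputable section

/-- Kummer's confluent hypergeometric function
`Φ(a, c, z) = ∑ₙ (a)ₙ / (c)ₙ * zⁿ / n!`, with `(a)ₙ = a (a + 1) ⋯ (a + n - 1)`. -/
def kummerPhi (a c z : ℂ) : ℂ :=
  ∑' n : ℕ, (ascPochhammer ℂ n).eval a / (ascPochhammer ℂ n).eval c * z ^ n / (n ! : ℂ)

/-- The generalized exponential function `e_μ(z) = e^z Φ(μ, 2μ + 1, -2z)`. -/
def genExp (μ : ℝ) (z : ℂ) : ℂ :=
  Complex.exp z * kummerPhi μ (2 * μ + 1) (-2 * z)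

/-- The generalized factorial: `γ_μ(2m) = 2^(2m) m! Γ(m + μ + 1/2) / Γ(μ + 1/2)` and
`γ_μ(2m + 1) = 2^(2m + 1) m! Γ(m + μ + 3/2) / Γ(μ + 1/2)`. -/
def genFactorial (μ : ℝ) (n : ℕ) : ℝ :=
  if Even n then
    2 ^ n * ((n / 2)! : ℝ) * Real.Gamma (((n / 2 : ℕ) : ℝ) + μ + 1 / 2) / Real.Gamma (μ + 1 / 2)
  else
    2 ^ n * ((n / 2)! : ℝ) * Real.Gamma (((n / 2 : ℕ) : ℝ) + μ + 3 / 2) / Real.Gamma (μ + 1 / 2)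

/-- The generalized Hermite polynomial `H_n^μ`, as a function on the real line. For `n = 2m` and
`n = 2m + 1` the number `m` is `n / 2`. -/
def genHermite (μ : ℝ) (n : ℕ) (x : ℝ) : ℝ :=
  if Even n then
    (-1) ^ (n / 2) * ((n ! : ℝ) / ((n / 2)! : ℝ)) *
      ∑ k ∈ Finset.range (n / 2 + 1), (-1) ^ k * ((n / 2).choose k : ℝ) *
        (Real.Gamma (μ + 1 / 2) / Real.Gamma ((k : ℝ) + μ + 1 / 2)) * x ^ (2 * k)
  else
    (-1) ^ (n / 2) * ((n ! : ℝ) / ((n / 2)! : ℝ)) *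
      ∑ k ∈ Finset.range (n / 2 + 1), (-1) ^ k * ((n / 2).choose k : ℝ) *
        (Real.Gamma (μ + 1 / 2) / Real.Gamma ((k : ℝ) + μ + 3 / 2)) * x ^ (2 * k + 1)

/-- The generalized Hermite function `φ_n^μ`. -/
def hermiteFun (μ : ℝ) (n : ℕ) (x : ℝ) : ℂ :=
  ((Real.sqrt (genFactorial μ n / Real.Gamma (μ + 1 / 2)) *
    (1 / ((2 : ℝ) ^ ((n : ℝ) / 2) * (n ! : ℝ))) *
    Real.exp (-(x ^ 2) / 2) * genHermite μ n x : ℝ) : ℂ)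

/-- The measure `|t|^(2μ) dt` on the real line. -/
def weightMeasure (μ : ℝ) : Measure ℝ :=
  volume.withDensity fun t => ENNReal.ofReal (|t| ^ (2 * μ))

/-- The Hilbert space `L²_μ(ℝ)`. -/
abbrev L2w (μ : ℝ) : Type := Lp ℂ 2 (weightMeasure μ)

/-- The linear span over `ℂ` of the functions `exp (-a t²) tⁿ`, `n = 0, 1, 2, …`. -/
def gaussSpan (a : ℝ) : Submodule ℂ (ℝ → ℂ) :=
  Submodule.span ℂ
    (Set.range fun (n : ℕ) (t : ℝ) => ((Real.exp (-(a * t ^ 2)) * t ^ n : ℝ) : ℂ))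

/-- The generalized Fourier integral, with kernel `e_μ(-ixt) |t|^(2μ)`. -/
def fourierIntegralW (μ : ℝ) (f : ℝ → ℂ) (x : ℝ) : ℂ :=
  (((2 : ℝ) ^ (μ + 1 / 2) * Real.Gamma (μ + 1 / 2) : ℝ) : ℂ)⁻¹ *
    ∫ t : ℝ, genExp μ (-Complex.I * x * t) * f t * ((|t| ^ (2 * μ) : ℝ) : ℂ)

/-- The generalized inverse Fourier integral, with kernel `e_μ(ixt) |t|^(2μ)`. -/
def fourierIntegralInvW (μ : ℝ) (f : ℝ → ℂ) (x : ℝ) : ℂ :=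
  (((2 : ℝ) ^ (μ + 1 / 2) * Real.Gamma (μ + 1 / 2) : ℝ) : ℂ)⁻¹ *
    ∫ t : ℝ, genExp μ (Complex.I * x * t) * f t * ((|t| ^ (2 * μ) : ℝ) : ℂ)

/-- The operator `G` on `L²_μ(ℝ)` is given on the span of the functions `exp (-a t²) tⁿ`, which
consists of square integrable functions, by the integral operator `T`. -/
def ExtendsOn (μ a : ℝ) (T : (ℝ → ℂ) → ℝ → ℂ) (G : L2w μ → L2w μ) : Prop :=
  ∀ f ∈ gaussSpan a, ∃ hf : MemLp f 2 (weightMeasure μ),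
    (G (hf.toLp f) : ℝ → ℂ) =ᵐ[weightMeasure μ] T f

end

/-!
Let `T` be the Dunkl operator `T xⁿ = (n + 2μ [n odd]) xⁿ⁻¹`. Kummer's equation says that
`e_μ = ∑ zⁿ / γ_μ(n)` is the eigenfunction `T e_μ = e_μ`, and `T` is antisymmetric for the weight
`|t|^(2μ)`. Hence the integral transform exchanges `T` with multiplication by `x`, up to factors
`± i`. It fixes `exp (-x²/2)`, because the transform of this function is annihilated by `T + x`, and
therefore it multiplies the `n`-th function obtained from `exp (-x²/2)` by the recursion
`Hₙ₊₁ = 2x Hₙ - T Hₙ` by `(-i)ⁿ`. These functions are the orthonormal basis of generalized Hermite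
functions, so the diagonal operator with entries `(-i)ⁿ` in this basis extends the transform from
the span of the Hermite functions. Multiplying by `exp (-ε t²)` and approximating in `L²` transfers
the formula to all the spaces `𝔖_a`.
-/

noncomputable section

open scoped Polynomial PowerSeries

variable {μ : ℝ}

/-! ### The power series of the generalized exponential function -/

/-- The coefficients of the Dunkl operator with parameter `μ`, which maps `xⁿ` to
`dunklCoeff μ n * xⁿ⁻¹`. -/
def dunklCoeff (μ : ℝ) (n : ℕ) : ℝ := if Even n then n else n + 2 * μ

theorem dunklCoeff_of_even (μ : ℝ) {n : ℕ} (hn : Even n) : dunklCoeff μ n = n := if_pos hn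

theorem dunklCoeff_of_odd (μ : ℝ) {n : ℕ} (hn : Odd n) : dunklCoeff μ n = n + 2 * μ :=
  if_neg (Nat.not_even_iff_odd.2 hn)

theorem dunklCoeff_zero (μ : ℝ) : dunklCoeff μ 0 = 0 := by simp [dunklCoeff]

theorem dunklCoeff_add_of_even (μ : ℝ) (n : ℕ) {l : ℕ} (hl : Even l) :
    dunklCoeff μ (n + l) = dunklCoeff μ n + l := by
  by_cases hn : Even n
  · simp [dunklCoeff, hn, hn.add hl]
  · have : ¬ Even (n + l) := by simp [Nat.even_add, hn, hl]
    simp only [dunklCoeff, hn, this, if_false]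
    push_cast
    ring

theorem dunklCoeff_succ_mul_add_one (μ : ℝ) (n : ℕ) :
    dunklCoeff μ (n + 1) * (dunklCoeff μ n + 1) = (n + 1) * (n + 1 + 2 * μ) := by
  rcases Nat.even_or_odd n with h | h
  · rw [dunklCoeff_of_odd μ h.add_one, dunklCoeff_of_even μ h]
    push_cast
    ring
  · rw [dunklCoeff_of_even μ h.add_one, dunklCoeff_of_odd μ h]
    push_cast
    ring

/-- A constant `r` such that `n ≤ r * dunklCoeff μ n`; the functions `genExp μ` and `exp (r * ·)`
can be compared coefficientwise. -/
def dunklRate (μ : ℝ) : ℝ := (min 1 (1 + 2 * μ))⁻¹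

theorem dunklRate_pos (hμ : -(1 / 2 : ℝ) < μ) : 0 < dunklRate μ :=
  inv_pos.2 (lt_min one_pos (by linarith))

theorem le_dunklRate_mul_dunklCoeff (hμ : -(1 / 2 : ℝ) < μ) (n : ℕ) :
    n ≤ dunklRate μ * dunklCoeff μ n := by
  have hpos : 0 < min 1 (1 + 2 * μ) := lt_min one_pos (by linarith)
  rw [dunklRate, inv_mul_eq_div, le_div_iff₀ hpos]
  rcases Nat.even_or_odd n with h | h
  · rw [dunklCoeff_of_even μ h]
    exact mul_le_of_le_one_right n.cast_nonneg (min_le_left _ _)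
  · rw [dunklCoeff_of_odd μ h]
    have hn : (1 : ℝ) ≤ n := by exact_mod_cast h.pos
    rcases le_total 0 μ with h0 | h0
    · nlinarith [min_le_left 1 (1 + 2 * μ)]
    · nlinarith [min_le_right 1 (1 + 2 * μ)]

theorem dunklCoeff_pos (hμ : -(1 / 2 : ℝ) < μ) {n : ℕ} (hn : 0 < n) : 0 < dunklCoeff μ n :=
  (mul_pos_iff_of_pos_left (dunklRate_pos hμ)).1
    ((Nat.cast_pos.2 hn).trans_le (le_dunklRate_mul_dunklCoeff hμ n))

theorem gamma_half_pos (hμ : -(1 / 2 : ℝ) < μ) : 0 < Real.Gamma (μ + 1 / 2) :=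
  Real.Gamma_pos_of_pos (by linarith)

theorem genFactorial_two_mul (μ : ℝ) (m : ℕ) :
    genFactorial μ (2 * m) =
      2 ^ (2 * m) * (m ! : ℝ) * Real.Gamma (m + μ + 1 / 2) / Real.Gamma (μ + 1 / 2) := by
  simp [genFactorial]

theorem genFactorial_two_mul_add_one (μ : ℝ) (m : ℕ) :
    genFactorial μ (2 * m + 1) =
      2 ^ (2 * m + 1) * (m ! : ℝ) * Real.Gamma (m + μ + 3 / 2) / Real.Gamma (μ + 1 / 2) := by
  simp [genFactorial, show (2 * m + 1) / 2 = m by omega]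

theorem genFactorial_zero (hμ : -(1 / 2 : ℝ) < μ) : genFactorial μ 0 = 1 := by
  rw [← Nat.mul_zero 2, genFactorial_two_mul]
  simpa using div_self (gamma_half_pos hμ).ne'

theorem genFactorial_succ (hμ : -(1 / 2 : ℝ) < μ) (n : ℕ) :
    genFactorial μ (n + 1) = dunklCoeff μ (n + 1) * genFactorial μ n := by
  rcases Nat.even_or_odd' n with ⟨m, rfl | rfl⟩
  · have hm : (m : ℝ) + μ + 1 / 2 ≠ 0 := by
      have : (0 : ℝ) ≤ m := m.cast_nonneg
      linarith
    rw [genFactorial_two_mul, genFactorial_two_mul_add_one, dunklCoeff_of_odd μ ⟨m, rfl⟩,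
      show (m : ℝ) + μ + 3 / 2 = m + μ + 1 / 2 + 1 by ring, Real.Gamma_add_one hm]
    push_cast
    ring
  · rw [show 2 * m + 1 + 1 = 2 * (m + 1) by ring, genFactorial_two_mul,
      genFactorial_two_mul_add_one, dunklCoeff_of_even μ (even_two_mul _), Nat.factorial_succ,
      show ((m + 1 : ℕ) : ℝ) + μ + 1 / 2 = m + μ + 3 / 2 by push_cast; ring]
    push_cast
    ring

theorem genFactorial_pos (hμ : -(1 / 2 : ℝ) < μ) (n : ℕ) : 0 < genFactorial μ n := by
  induction n with
  | zero => simp [genFactorial_zero hμ]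
  | succ n ih =>
    rw [genFactorial_succ hμ]
    exact mul_pos (dunklCoeff_pos hμ n.succ_pos) ih

theorem factorial_le_dunklRate_pow_mul_genFactorial (hμ : -(1 / 2 : ℝ) < μ) (n : ℕ) :
    (n ! : ℝ) ≤ dunklRate μ ^ n * genFactorial μ n := by
  induction n with
  | zero => simp [genFactorial_zero hμ]
  | succ n ih =>
    have hn := le_dunklRate_mul_dunklCoeff hμ (n + 1)
    calc ((n + 1)! : ℝ) = ((n + 1 : ℕ) : ℝ) * n ! := by rw [Nat.factorial_succ]; push_cast; ring
      _ ≤ (dunklRate μ * dunklCoeff μ (n + 1)) * (dunklRate μ ^ n * genFactorial μ n) :=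
        mul_le_mul hn ih (by positivity) ((Nat.cast_nonneg _).trans hn)
      _ = _ := by rw [genFactorial_succ hμ]; ring

theorem norm_inv_genFactorial_le (hμ : -(1 / 2 : ℝ) < μ) (n : ℕ) :
    ‖(genFactorial μ n : ℂ)⁻¹‖ ≤ dunklRate μ ^ n / n ! := by
  have hγ := genFactorial_pos hμ n
  rw [norm_inv, Complex.norm_real, Real.norm_of_nonneg hγ.le, inv_eq_one_div,
    div_le_div_iff₀ hγ (by positivity), one_mul]
  exact factorial_le_dunklRate_pow_mul_genFactorial hμ n

/-- The Dunkl operator with parameter `μ` on formal power series. -/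
def dunklSeries (μ : ℝ) : ℂ⟦X⟧ →ₗ[ℂ] ℂ⟦X⟧ where
  toFun f := PowerSeries.mk fun n => (dunklCoeff μ (n + 1) : ℂ) * PowerSeries.coeff (n + 1) f
  map_add' f g := by ext; simp [mul_add]
  map_smul' c f := by ext; simp [mul_left_comm]

@[simp]
theorem coeff_dunklSeries (μ : ℝ) (f : ℂ⟦X⟧) (n : ℕ) :
    PowerSeries.coeff n (dunklSeries μ f) =
      (dunklCoeff μ (n + 1) : ℂ) * PowerSeries.coeff (n + 1) f := by
  simp [dunklSeries]

theorem coeff_X_mul_dunklSeries (μ : ℝ) (f : ℂ⟦X⟧) (n : ℕ) :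
    PowerSeries.coeff n (PowerSeries.X * dunklSeries μ f) =
      (dunklCoeff μ n : ℂ) * PowerSeries.coeff n f := by
  cases n with
  | zero => simp [dunklCoeff_zero]
  | succ n => simp

theorem eq_of_dunklSeries_eq_mul (hμ : -(1 / 2 : ℝ) < μ) {f g q : ℂ⟦X⟧}
    (hf : dunklSeries μ f = q * f) (hg : dunklSeries μ g = q * g)
    (h0 : PowerSeries.constantCoeff f = PowerSeries.constantCoeff g) : f = g := by
  ext n
  induction n using Nat.strong_induction_on with
  | _ n ih =>
    cases n with
    | zero => simpa using h0
    | succ n =>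
      have hd : (dunklCoeff μ (n + 1) : ℂ) ≠ 0 := by
        exact_mod_cast (dunklCoeff_pos hμ n.succ_pos).ne'
      refine mul_left_cancel₀ hd ?_
      rw [← coeff_dunklSeries, ← coeff_dunklSeries, hf, hg, PowerSeries.coeff_mul,
        PowerSeries.coeff_mul]
      refine Finset.sum_congr rfl fun kl hkl => ?_
      rw [ih kl.2 (by have := Finset.HasAntidiagonal.mem_antidiagonal.1 hkl; omega)]

theorem dunklSeries_mul_of_even (μ : ℝ) (f : ℂ⟦X⟧) {g : ℂ⟦X⟧}
    (hg : ∀ n, ¬ Even n → PowerSeries.coeff n g = 0) :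
    dunklSeries μ (f * g) = dunklSeries μ f * g + f * dunklSeries μ g := by
  -- Multiplied by `X`, the claim is the additivity `d_(k + l) = d_k + d_l` for even `l`.
  refine mul_left_cancel₀ (PowerSeries.X_ne_zero (R := ℂ)) ?_
  have hX : PowerSeries.X * (dunklSeries μ f * g + f * dunklSeries μ g) =
      PowerSeries.X * dunklSeries μ f * g + f * (PowerSeries.X * dunklSeries μ g) := by ring
  rw [hX]
  ext n
  rw [coeff_X_mul_dunklSeries, map_add, PowerSeries.coeff_mul, PowerSeries.coeff_mul,
    PowerSeries.coeff_mul, Finset.mul_sum, ← Finset.sum_add_distrib]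
  refine Finset.sum_congr rfl fun kl hkl => ?_
  rw [← Finset.HasAntidiagonal.mem_antidiagonal.1 hkl, coeff_X_mul_dunklSeries,
    coeff_X_mul_dunklSeries]
  by_cases hl : Even kl.2
  · rw [dunklCoeff_add_of_even μ _ hl, dunklCoeff_of_even μ hl]
    push_cast
    ring
  · simp [hg _ hl]

theorem hasSum_coeff_mul_mul_pow {f g : ℂ⟦X⟧} {z A B : ℂ}
    (hf : HasSum (fun n => PowerSeries.coeff n f * z ^ n) A)
    (hg : HasSum (fun n => PowerSeries.coeff n g * z ^ n) B) :
    HasSum (fun n => PowerSeries.coeff n (f * g) * z ^ n) (A * B) := by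
  have hcauchy := fun n => show
      ∑ kl ∈ Finset.HasAntidiagonal.antidiagonal n, PowerSeries.coeff kl.1 f * z ^ kl.1 *
        (PowerSeries.coeff kl.2 g * z ^ kl.2) = PowerSeries.coeff n (f * g) * z ^ n by
    rw [PowerSeries.coeff_mul, Finset.sum_mul]
    refine Finset.sum_congr rfl fun kl hkl => ?_
    rw [← Finset.HasAntidiagonal.mem_antidiagonal.1 hkl, pow_add]
    ring
  have hsum := (summable_norm_sum_mul_antidiagonal_of_summable_norm
    hf.summable.norm hg.summable.norm).of_norm
  have htsum := tsum_mul_tsum_eq_tsum_sum_antidiagonal_of_summable_norm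
    hf.summable.norm hg.summable.norm
  simp_rw [hcauchy] at hsum htsum
  rw [← hf.tsum_eq, ← hg.tsum_eq, htsum]
  exact hsum.hasSum

theorem hasSum_coeff_exp_mul_pow (z : ℂ) :
    HasSum (fun n => PowerSeries.coeff n (PowerSeries.exp ℂ) * z ^ n) (Complex.exp z) := by
  rw [Complex.exp_eq_exp_ℂ]
  refine (NormedSpace.expSeries_div_hasSum_exp z).congr_fun fun n => ?_
  simp [PowerSeries.coeff_exp, div_eq_inv_mul]

theorem derivative_rescale {R : Type*} [CommSemiring R] (a : R) (f : R⟦X⟧) :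
    PowerSeries.derivative R (PowerSeries.rescale a f) =
      PowerSeries.C a * PowerSeries.rescale a (PowerSeries.derivative R f) := by
  ext n
  simp only [PowerSeries.coeff_derivative, PowerSeries.coeff_rescale, PowerSeries.coeff_C_mul]
  ring

/-- Kummer's confluent hypergeometric function `Φ(a, c, ·)` as a formal power series. -/
def kummerSeries (a c : ℂ) : ℂ⟦X⟧ :=
  PowerSeries.mk fun n => (ascPochhammer ℂ n).eval a / (ascPochhammer ℂ n).eval c / (n ! : ℂ)

theorem coeff_kummerSeries_succ (a c : ℂ) (n : ℕ) :
    PowerSeries.coeff (n + 1) (kummerSeries a c) =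
      (a + n) / ((c + n) * (n + 1)) * PowerSeries.coeff n (kummerSeries a c) := by
  simp only [kummerSeries, PowerSeries.coeff_mk, ascPochhammer_succ_eval, Nat.factorial_succ,
    Nat.cast_mul, Nat.cast_add, Nat.cast_one, div_eq_mul_inv, mul_inv]
  ring

theorem summable_coeff_kummerSeries_mul_pow (a c z : ℂ) :
    Summable fun n => PowerSeries.coeff n (kummerSeries a c) * z ^ n := by
  have hratio : Filter.Tendsto (fun n : ℕ => (a + n) / ((c + n) * (n + 1)) * z)
      Filter.atTop (nhds 0) := by
    have h1 := tendsto_add_mul_div_add_mul_atTop_nhds a c 1 (one_ne_zero (α := ℂ))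
    have h2 := (tendsto_one_div_add_atTop_nhds_zero_nat (𝕜 := ℂ)).mul_const z
    refine ((h1.mul h2).congr fun n => ?_).trans_eq (by simp)
    simp only [div_eq_mul_inv, mul_inv]
    ring
  refine summable_of_ratio_norm_eventually_le (r := 1 / 2) (by norm_num) ?_
  filter_upwards [hratio.norm.eventually_le_const (by simp : ‖(0 : ℂ)‖ < 1 / 2)] with n hn
  calc ‖PowerSeries.coeff (n + 1) (kummerSeries a c) * z ^ (n + 1)‖
      = ‖(a + n) / ((c + n) * (n + 1)) * z‖ *
          ‖PowerSeries.coeff n (kummerSeries a c) * z ^ n‖ := by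
        rw [coeff_kummerSeries_succ, ← norm_mul]
        ring_nf
    _ ≤ _ := by gcongr

theorem hasSum_kummerPhi (a c z : ℂ) :
    HasSum (fun n => PowerSeries.coeff n (kummerSeries a c) * z ^ n) (kummerPhi a c z) := by
  convert (summable_coeff_kummerSeries_mul_pow a c z).hasSum using 1
  refine tsum_congr fun n => ?_
  rw [kummerSeries, PowerSeries.coeff_mk]
  ring

open PowerSeries in
theorem kummerSeries_ode (a : ℂ) {c : ℂ} (hc : ∀ n : ℕ, c + n ≠ 0) :
    X * derivative ℂ (derivative ℂ (kummerSeries a c)) +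
      (C c - X) * derivative ℂ (kummerSeries a c) = C a * kummerSeries a c := by
  ext n
  have hn : (n : ℂ) + 1 ≠ 0 := n.cast_add_one_ne_zero
  have hrec : (c + n) * (n + 1) * coeff (n + 1) (kummerSeries a c) =
      (a + n) * coeff n (kummerSeries a c) := by
    have := hc n
    rw [coeff_kummerSeries_succ]
    field_simp
  cases n <;>
  · simp only [sub_mul, map_add, map_sub, coeff_C_mul, coeff_zero_X_mul, coeff_succ_X_mul,
      coeff_derivative] at hrec ⊢
    push_cast at hrec ⊢
    linear_combination hrec

/-- The Taylor series of `genExp μ`, as it is defined: `e^z Φ(μ, 2μ + 1, -2z)`. -/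
def genExpSeries (μ : ℝ) : ℂ⟦X⟧ :=
  PowerSeries.exp ℂ * PowerSeries.rescale (-2) (kummerSeries μ (2 * μ + 1))

theorem hasSum_coeff_genExpSeries_mul_pow (μ : ℝ) (z : ℂ) :
    HasSum (fun n => PowerSeries.coeff n (genExpSeries μ) * z ^ n) (genExp μ z) := by
  refine hasSum_coeff_mul_mul_pow (hasSum_coeff_exp_mul_pow z) ?_
  refine (hasSum_kummerPhi μ (2 * μ + 1) (-2 * z)).congr_fun fun n => ?_
  rw [PowerSeries.coeff_rescale, mul_pow]
  ring

open PowerSeries in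
theorem genExpSeries_ode (hμ : -(1 / 2 : ℝ) < μ) :
    X * derivative ℂ (derivative ℂ (genExpSeries μ)) +
      C (2 * μ + 1 : ℂ) * derivative ℂ (genExpSeries μ) = (1 + X) * genExpSeries μ := by
  have hc : ∀ n : ℕ, (2 * μ + 1 : ℂ) + n ≠ 0 := fun n => by
    have : 0 < 2 * μ + 1 + n := by
      have : (0 : ℝ) ≤ n := n.cast_nonneg
      linarith
    exact_mod_cast this.ne'
  have hode := congrArg (rescale (-2 : ℂ)) (kummerSeries_ode μ hc)
  have hC : ∀ z : ℂ, rescale (-2 : ℂ) (C z) = C z := fun z => by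
    ext n
    simp +contextual [coeff_rescale, coeff_C]
  have hexp : derivative ℂ (PowerSeries.exp ℂ) = PowerSeries.exp ℂ := derivative_exp ℂ
  simp only [map_add, map_sub, map_mul, rescale_X, hC] at hode
  simp only [genExpSeries, Derivation.leibniz, map_add, hexp, derivative_rescale, smul_eq_mul,
    derivative_C, mul_zero, add_zero]
  simp only [map_neg, map_one, map_ofNat, map_mul] at hode ⊢
  linear_combination (-2 * PowerSeries.exp ℂ) * hode

open PowerSeries in
theorem X_mul_derivative_derivative_add (μ : ℝ) (f : ℂ⟦X⟧) :
    X * derivative ℂ (derivative ℂ f) + C (2 * μ + 1 : ℂ) * derivative ℂ f =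
      X * dunklSeries μ (dunklSeries μ f) + dunklSeries μ f := by
  ext n
  have hd : (dunklCoeff μ (n + 1) : ℂ) * (dunklCoeff μ n + 1) = (n + 1) * (n + 1 + 2 * μ) := by
    exact_mod_cast dunklCoeff_succ_mul_add_one μ n
  simp only [map_add (coeff n), coeff_X_mul_dunklSeries, coeff_dunklSeries, coeff_C_mul]
  cases n <;>
  · simp only [coeff_zero_X_mul, coeff_succ_X_mul, coeff_derivative]
    push_cast at hd ⊢
    linear_combination -coeff (_ + 1) f * hd

theorem dunklSeries_genExpSeries (hμ : -(1 / 2 : ℝ) < μ) :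
    dunklSeries μ (genExpSeries μ) = genExpSeries μ := by
  set u := dunklSeries μ (genExpSeries μ) - genExpSeries μ with hu
  have hode : PowerSeries.X * dunklSeries μ u + u = -(PowerSeries.X * u) := by
    have := (X_mul_derivative_derivative_add μ _).symm.trans (genExpSeries_ode hμ)
    rw [hu, map_sub]
    linear_combination this
  have hrec : ∀ n, ((dunklCoeff μ n : ℂ) + 1) * PowerSeries.coeff n u =
      -PowerSeries.coeff n (PowerSeries.X * u) := fun n => by
    rw [← map_neg, ← hode, map_add, coeff_X_mul_dunklSeries]
    ring
  suffices u = 0 from sub_eq_zero.1 this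
  ext n
  induction n with
  | zero => simpa [dunklCoeff_zero] using hrec 0
  | succ n ih =>
    have hd : (dunklCoeff μ (n + 1) : ℂ) + 1 ≠ 0 := by
      exact_mod_cast (add_pos (dunklCoeff_pos hμ n.succ_pos) one_pos).ne'
    have h := hrec (n + 1)
    rw [PowerSeries.coeff_succ_X_mul, ih, map_zero, neg_zero] at h
    simpa using (mul_eq_zero.1 h).resolve_left hd

theorem coeff_genExpSeries (hμ : -(1 / 2 : ℝ) < μ) (n : ℕ) :
    PowerSeries.coeff n (genExpSeries μ) = (genFactorial μ n : ℂ)⁻¹ := by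
  have h : genExpSeries μ = PowerSeries.mk fun n => (genFactorial μ n : ℂ)⁻¹ := by
    refine eq_of_dunklSeries_eq_mul hμ (q := 1) ?_ ?_ ?_
    · rw [one_mul, dunklSeries_genExpSeries hμ]
    · ext n
      have hd : (dunklCoeff μ (n + 1) : ℂ) ≠ 0 := by
        exact_mod_cast (dunklCoeff_pos hμ n.succ_pos).ne'
      rw [coeff_dunklSeries, one_mul, PowerSeries.coeff_mk, PowerSeries.coeff_mk,
        genFactorial_succ hμ, Complex.ofReal_mul, mul_inv, mul_inv_cancel_left₀ hd]
    · rw [← PowerSeries.coeff_zero_eq_constantCoeff_apply,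
        ← PowerSeries.coeff_zero_eq_constantCoeff_apply, PowerSeries.coeff_mk,
        genFactorial_zero hμ]
      simp [genExpSeries, PowerSeries.coeff_mul, PowerSeries.coeff_rescale, kummerSeries]
  rw [h, PowerSeries.coeff_mk]

theorem hasSum_genExp (hμ : -(1 / 2 : ℝ) < μ) (z : ℂ) :
    HasSum (fun n => (genFactorial μ n : ℂ)⁻¹ * z ^ n) (genExp μ z) := by
  simpa only [coeff_genExpSeries hμ] using hasSum_coeff_genExpSeries_mul_pow μ z

theorem norm_genExp_le (hμ : -(1 / 2 : ℝ) < μ) (z : ℂ) :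
    ‖genExp μ z‖ ≤ Real.exp (dunklRate μ * ‖z‖) := by
  have hs : HasSum (fun n : ℕ => (dunklRate μ * ‖z‖) ^ n / n !) (Real.exp (dunklRate μ * ‖z‖)) := by
    rw [Real.exp_eq_exp_ℝ]
    exact NormedSpace.expSeries_div_hasSum_exp _
  refine (hasSum_genExp hμ z).norm_le_of_bounded hs fun n => ?_
  rw [norm_mul, norm_pow, mul_pow, mul_div_right_comm]
  gcongr
  exact norm_inv_genFactorial_le hμ n

theorem continuous_genExp (hμ : -(1 / 2 : ℝ) < μ) : Continuous (genExp μ) := by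
  have hseries : genExp μ = fun z => ∑' n, (genFactorial μ n : ℂ)⁻¹ * z ^ n :=
    funext fun z => (hasSum_genExp hμ z).tsum_eq.symm
  refine continuous_iff_continuousAt.2 fun z₀ => ?_
  have hball : ContinuousOn (genExp μ) (Metric.ball 0 (‖z₀‖ + 1)) := by
    rw [hseries]
    refine continuousOn_tsum (u := fun n : ℕ => (dunklRate μ * (‖z₀‖ + 1)) ^ n / n !)
      (fun n => by fun_prop) (Real.summable_pow_div_factorial _) fun n z hz => ?_
    have hz' : ‖z‖ ≤ ‖z₀‖ + 1 := (mem_ball_zero_iff.1 hz).le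
    rw [norm_mul, norm_pow, mul_pow, mul_div_right_comm]
    have := (norm_nonneg _).trans (norm_inv_genFactorial_le hμ n)
    gcongr
    exact norm_inv_genFactorial_le hμ n
  exact hball.continuousAt (Metric.isOpen_ball.mem_nhds (by simp))

/-! ### Gaussian functions and the weight -/

theorem integrable_weightMeasure_iff {E : Type*} [NormedAddCommGroup E] [NormedSpace ℝ E]
    {f : ℝ → E} :
    Integrable f (weightMeasure μ) ↔ Integrable fun t => |t| ^ (2 * μ) • f t := by
  rw [weightMeasure, integrable_withDensity_iff_integrable_smul' (by fun_prop)
    (Filter.Eventually.of_forall fun t => ENNReal.ofReal_lt_top)]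
  have htoReal := fun t : ℝ => ENNReal.toReal_ofReal (Real.rpow_nonneg (abs_nonneg t) (2 * μ))
  simp only [htoReal]

theorem integral_weightMeasure {E : Type*} [NormedAddCommGroup E] [NormedSpace ℝ E]
    (f : ℝ → E) : ∫ t, f t ∂(weightMeasure μ) = ∫ t, |t| ^ (2 * μ) • f t := by
  rw [weightMeasure, integral_withDensity_eq_integral_toReal_smul (by fun_prop)
    (Filter.Eventually.of_forall fun t => ENNReal.ofReal_lt_top)]
  have htoReal := fun t : ℝ => ENNReal.toReal_ofReal (Real.rpow_nonneg (abs_nonneg t) (2 * μ))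
  simp only [htoReal]

theorem integrable_of_even_of_integrableOn_Ioi {E : Type*} [NormedAddCommGroup E] {f : ℝ → E}
    (heven : ∀ x, f (-x) = f x) (hf : IntegrableOn f (Set.Ioi 0)) : Integrable f := by
  rw [← integrableOn_univ, ← @Set.Iio_union_Ici _ _ (0 : ℝ), integrableOn_union,
    integrableOn_Ici_iff_integrableOn_Ioi]
  refine ⟨?_, hf⟩
  rw [← (Measure.measurePreserving_neg (volume : Measure ℝ)).integrableOn_comp_preimage
    (Homeomorph.neg ℝ).measurableEmbedding]
  simpa [Function.comp_def, heven] using hf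

theorem integrable_gaussian_weightMeasure (hμ : -(1 / 2 : ℝ) < μ) {a : ℝ} (ha : 0 < a) :
    Integrable (fun t : ℝ => Real.exp (-(a * t ^ 2))) (weightMeasure μ) := by
  refine integrable_weightMeasure_iff.2
    (integrable_of_even_of_integrableOn_Ioi (fun x => by simp) ?_)
  refine (integrableOn_rpow_mul_exp_neg_mul_sq ha (s := 2 * μ) (by linarith)).congr_fun
    (fun x (hx : 0 < x) => ?_) measurableSet_Ioi
  simp [abs_of_pos hx]

theorem exp_abs_mul_gaussian_le {a : ℝ} (ha : 0 < a) (c t : ℝ) :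
    Real.exp (c * |t|) * Real.exp (-(a * t ^ 2)) ≤
      Real.exp (c ^ 2 / (2 * a)) * Real.exp (-(a / 2 * t ^ 2)) := by
  rw [← Real.exp_add, ← Real.exp_add, Real.exp_le_exp, ← sub_nonneg, ← sq_abs t]
  have hsquare : c ^ 2 / (2 * a) + -(a / 2 * |t| ^ 2) - (c * |t| + -(a * |t| ^ 2)) =
      (c - a * |t|) ^ 2 / (2 * a) := by
    field_simp
    ring
  rw [hsquare]
  positivity

theorem integrable_exp_abs_mul_gaussian (hμ : -(1 / 2 : ℝ) < μ) {a : ℝ} (ha : 0 < a) (c : ℝ) :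
    Integrable (fun t : ℝ => Real.exp (c * |t|) * Real.exp (-(a * t ^ 2))) (weightMeasure μ) := by
  refine ((integrable_gaussian_weightMeasure hμ (half_pos ha)).const_mul
    (Real.exp (c ^ 2 / (2 * a)))).mono' (by fun_prop) (Filter.Eventually.of_forall fun t => ?_)
  rw [Real.norm_of_nonneg (by positivity)]
  exact exp_abs_mul_gaussian_le ha c t

theorem memLp_exp_abs_mul_gaussian (hμ : -(1 / 2 : ℝ) < μ) {a : ℝ} (ha : 0 < a) (c : ℝ) :
    MemLp (fun t : ℝ => Real.exp (c * |t|) * Real.exp (-(a * t ^ 2))) 2 (weightMeasure μ) := by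
  rw [memLp_two_iff_integrable_sq (by fun_prop)]
  refine (integrable_exp_abs_mul_gaussian hμ (a := 2 * a) (by positivity) (2 * c)).congr
    (Filter.Eventually.of_forall fun t => ?_)
  simp only [← Real.exp_add, ← Real.exp_nat_mul]
  push_cast
  ring_nf

/-- The moments `∫ tⁿ exp (-a t²) |t|^(2μ) dt`. -/
def gaussMoment (μ a : ℝ) (n : ℕ) : ℝ :=
  ∫ t, t ^ n * Real.exp (-(a * t ^ 2)) ∂(weightMeasure μ)

theorem gaussMoment_of_odd (μ a : ℝ) {n : ℕ} (hn : Odd n) : gaussMoment μ a n = 0 := by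
  rw [gaussMoment, integral_weightMeasure, ← self_eq_neg, ← integral_neg, ← integral_neg_eq_self]
  refine integral_congr_ae (Filter.Eventually.of_forall fun t => ?_)
  simp [hn.neg_pow]

theorem gaussMoment_of_even (hμ : -(1 / 2 : ℝ) < μ) {a : ℝ} (ha : 0 < a) {n : ℕ} (hn : Even n) :
    gaussMoment μ a n = a ^ (-(n + 2 * μ + 1) / 2) * Real.Gamma ((n + 2 * μ + 1) / 2) := by
  have habs : ∀ t : ℝ, |t| ^ (2 * μ) • (t ^ n * Real.exp (-(a * t ^ 2))) =
      |t| ^ (2 * μ) * (|t| ^ n * Real.exp (-(a * |t| ^ 2))) := fun t => by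
    rw [hn.pow_abs, sq_abs, smul_eq_mul]
  have hIoi : ∫ x in Set.Ioi (0 : ℝ), x ^ (2 * μ) * (x ^ n * Real.exp (-(a * x ^ 2))) =
      ∫ x in Set.Ioi (0 : ℝ), x ^ ((n : ℝ) + 2 * μ) * Real.exp (-a * x ^ (2 : ℝ)) := by
    refine setIntegral_congr_fun measurableSet_Ioi fun x (hx : 0 < x) => ?_
    simp only [Real.rpow_add hx, Real.rpow_natCast, Real.rpow_two, neg_mul]
    ring
  rw [gaussMoment, integral_weightMeasure]
  simp_rw [habs]
  rw [integral_comp_abs (f := fun t => t ^ (2 * μ) * (t ^ n * Real.exp (-(a * t ^ 2)))), hIoi,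
    integral_rpow_mul_exp_neg_mul_rpow two_pos (by linarith [n.cast_nonneg (α := ℝ)]) ha]
  ring

theorem gaussMoment_zero (hμ : -(1 / 2 : ℝ) < μ) {a : ℝ} (ha : 0 < a) :
    gaussMoment μ a 0 = a ^ (-(μ + 1 / 2)) * Real.Gamma (μ + 1 / 2) := by
  rw [gaussMoment_of_even hμ ha Even.zero]
  congr 2 <;> (push_cast; ring)

theorem gaussMoment_add_two (hμ : -(1 / 2 : ℝ) < μ) {a : ℝ} (ha : 0 < a) (n : ℕ) :
    2 * a * gaussMoment μ a (n + 2) = dunklCoeff μ (n + 1) * gaussMoment μ a n := by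
  rcases Nat.even_or_odd n with h | h
  · have hpos : ((n : ℝ) + 2 * μ + 1) / 2 ≠ 0 := by
      have : (0 : ℝ) ≤ n := n.cast_nonneg
      linarith
    rw [gaussMoment_of_even hμ ha h, gaussMoment_of_even hμ ha (h.add even_two),
      dunklCoeff_of_odd μ h.add_one,
      show (((n + 2 : ℕ) : ℝ) + 2 * μ + 1) / 2 = (n + 2 * μ + 1) / 2 + 1 by push_cast; ring,
      show -(((n + 2 : ℕ) : ℝ) + 2 * μ + 1) / 2 = -(n + 2 * μ + 1) / 2 - 1 by push_cast; ring,
      Real.Gamma_add_one hpos, Real.rpow_sub_one ha.ne']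
    push_cast
    field_simp
    ring
  · rw [gaussMoment_of_odd μ a h, gaussMoment_of_odd μ a (h.add_even even_two)]
    simp

theorem hasSum_mul_integral_pow_mul {ν : Measure ℝ} {f : ℝ → ℂ} {c : ℕ → ℂ} {A : ℂ → ℂ} {r : ℝ}
    {z : ℂ} (hc : ∀ n, ‖c n‖ ≤ r ^ n / n !) (hA : ∀ w, HasSum (fun n => c n * w ^ n) (A w))
    (hfm : AEStronglyMeasurable f ν)
    (hf : Integrable (fun t => Real.exp (r * ‖z‖ * |t|) • f t) ν) :
    HasSum (fun n => c n * z ^ n * ∫ t, (t : ℂ) ^ n * f t ∂ν) (∫ t, A (z * t) * f t ∂ν) := by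
  have hexp : ∀ t : ℝ, HasSum (fun n : ℕ => (r * ‖z‖ * |t|) ^ n / n ! * ‖f t‖)
      ‖Real.exp (r * ‖z‖ * |t|) • f t‖ := fun t => by
    rw [norm_smul, Real.norm_of_nonneg (Real.exp_pos _).le, Real.exp_eq_exp_ℝ]
    have := NormedSpace.expSeries_div_hasSum_exp (r * ‖z‖ * |t|)
    exact this.mul_right ‖f t‖
  have hterm : ∀ n, AEStronglyMeasurable (fun t : ℝ => c n * z ^ n * ((t : ℂ) ^ n * f t)) ν :=
    fun n => (((by fun_prop : Continuous fun t : ℝ => (t : ℂ) ^ n).aestronglyMeasurable).mul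
      hfm).const_mul _
  have hbound : ∀ n (t : ℝ), ‖c n * z ^ n * ((t : ℂ) ^ n * f t)‖ ≤
      (r * ‖z‖ * |t|) ^ n / n ! * ‖f t‖ := fun n t => by
    rw [norm_mul, norm_mul, norm_mul, norm_pow, norm_pow, Complex.norm_real, Real.norm_eq_abs]
    calc ‖c n‖ * ‖z‖ ^ n * (|t| ^ n * ‖f t‖) ≤ r ^ n / n ! * ‖z‖ ^ n * (|t| ^ n * ‖f t‖) := by
          gcongr
          exact hc n
      _ = _ := by ring
  have hdom : Integrable (fun t : ℝ => ∑' n : ℕ, (r * ‖z‖ * |t|) ^ n / n ! * ‖f t‖) ν := by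
    simpa only [(hexp _).tsum_eq] using hf.norm
  have hlim : ∀ t : ℝ, HasSum (fun n => c n * z ^ n * ((t : ℂ) ^ n * f t)) (A (z * t) * f t) :=
    fun t => ((hA (z * t)).mul_right (f t)).congr_fun fun n => by ring
  have hsum := hasSum_integral_of_dominated_convergence _ hterm
    (fun n => Filter.Eventually.of_forall (hbound n))
    (Filter.Eventually.of_forall fun t => (hexp t).summable)
    hdom (Filter.Eventually.of_forall hlim)
  simpa only [integral_const_mul] using hsum

/-! ### Density of the Gaussian functions -/

theorem charFun_withDensity_ofReal {ν : Measure ℝ} {f : ℝ → ℝ} (hf : AEMeasurable f ν) (x : ℝ) :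
    charFun (ν.withDensity fun t => ENNReal.ofReal (f t)) x =
      ∫ t, Complex.exp (x * t * Complex.I) * (max (f t) 0 : ℝ) ∂ν := by
  rw [charFun_apply_real, integral_withDensity_eq_integral_toReal_smul₀ hf.ennreal_ofReal
    (Filter.Eventually.of_forall fun t => ENNReal.ofReal_lt_top)]
  simp only [ENNReal.toReal_ofReal', Complex.real_smul, mul_comm]

theorem integrable_cexp_mul_I_mul {ν : Measure ℝ} {f : ℝ → ℂ} (hf : Integrable f ν) (x : ℝ) :
    Integrable (fun t : ℝ => Complex.exp (x * t * Complex.I) * f t) ν := by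
  refine hf.bdd_mul (c := 1) (by fun_prop) (Filter.Eventually.of_forall fun t => ?_)
  rw [← Complex.ofReal_mul, Complex.norm_exp_ofReal_mul_I]

theorem ae_eq_zero_of_forall_integral_cexp_mul_ofReal_eq_zero {ν : Measure ℝ} {f : ℝ → ℝ}
    (hf : Integrable f ν) (h : ∀ x : ℝ, ∫ t, Complex.exp (x * t * Complex.I) * f t ∂ν = 0) :
    f =ᵐ[ν] 0 := by
  have := isFiniteMeasure_withDensity hf.lintegral_lt_top.ne
  have := isFiniteMeasure_withDensity hf.neg.lintegral_lt_top.ne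
  have hint : ∀ {g : ℝ → ℝ}, Integrable g ν → ∀ x : ℝ,
      Integrable (fun t : ℝ => Complex.exp (x * t * Complex.I) * (max (g t) 0 : ℝ)) ν :=
    fun hg x => integrable_cexp_mul_I_mul hg.pos_part.ofReal x
  have heq : ν.withDensity (fun t => ENNReal.ofReal (f t)) =
      ν.withDensity (fun t => ENNReal.ofReal ((-f) t)) := by
    refine Measure.ext_of_charFun (funext fun x => ?_)
    rw [charFun_withDensity_ofReal hf.aemeasurable, charFun_withDensity_ofReal hf.neg.aemeasurable,
      ← sub_eq_zero, ← integral_sub (hint hf x) (hint hf.neg x), ← h x]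
    refine integral_congr_ae (Filter.Eventually.of_forall fun t => ?_)
    simp only [Pi.neg_apply]
    rw [← mul_sub, ← Complex.ofReal_sub, max_zero_sub_max_neg_zero_eq_self]
  rw [withDensity_eq_iff hf.aemeasurable.ennreal_ofReal hf.neg.aemeasurable.ennreal_ofReal
    hf.lintegral_lt_top.ne] at heq
  filter_upwards [heq] with t ht
  have hmax := congrArg ENNReal.toReal ht
  rw [ENNReal.toReal_ofReal', ENNReal.toReal_ofReal', Pi.neg_apply] at hmax
  rw [← max_zero_sub_max_neg_zero_eq_self (f t), hmax, sub_self, Pi.zero_apply]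

theorem ae_eq_zero_of_forall_integral_cexp_mul_eq_zero {ν : Measure ℝ} {f : ℝ → ℂ}
    (hf : Integrable f ν) (h : ∀ x : ℝ, ∫ t, Complex.exp (x * t * Complex.I) * f t ∂ν = 0) :
    f =ᵐ[ν] 0 := by
  have hconj : ∀ x : ℝ, ∫ t, Complex.exp (x * t * Complex.I) * (starRingEnd ℂ) (f t) ∂ν = 0 :=
      fun x => by
    rw [← (starRingEnd ℂ).map_zero, ← h (-x), ← integral_conj]
    simp [← Complex.exp_conj]
  have hstar : Integrable (fun t => (starRingEnd ℂ) (f t)) ν :=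
    (LinearIsometryEquiv.integrable_comp_iff (RCLike.conjLIE (K := ℂ))).2 hf
  have hre : (fun t => (f t).re) =ᵐ[ν] 0 := by
    refine ae_eq_zero_of_forall_integral_cexp_mul_ofReal_eq_zero hf.re fun x => ?_
    simp_rw [Complex.re_eq_add_conj, ← mul_div_assoc, mul_add, integral_div]
    rw [integral_add (integrable_cexp_mul_I_mul hf x) (integrable_cexp_mul_I_mul hstar x), h,
      hconj, add_zero, zero_div]
  have him : (fun t => (f t).im) =ᵐ[ν] 0 := by
    refine ae_eq_zero_of_forall_integral_cexp_mul_ofReal_eq_zero hf.im fun x => ?_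
    simp_rw [Complex.im_eq_sub_conj, ← mul_div_assoc, mul_sub, integral_div]
    rw [integral_sub (integrable_cexp_mul_I_mul hf x) (integrable_cexp_mul_I_mul hstar x), h,
      hconj, sub_zero, zero_div]
  filter_upwards [hre, him] with t ht ht'
  exact Complex.ext ht ht'

theorem ae_eq_zero_of_forall_integral_pow_mul_eq_zero {ν : Measure ℝ} {f : ℝ → ℂ}
    (hf : ∀ c : ℝ, Integrable (fun t => Real.exp (c * |t|) • f t) ν)
    (h : ∀ n : ℕ, ∫ t, (t : ℂ) ^ n * f t ∂ν = 0) : f =ᵐ[ν] 0 := by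
  have hf0 : Integrable f ν := by simpa using hf 0
  refine ae_eq_zero_of_forall_integral_cexp_mul_eq_zero hf0 fun x => ?_
  have hsum := hasSum_mul_integral_pow_mul (r := 1) (z := x * Complex.I)
    (fun n => by simp [PowerSeries.coeff_exp]) hasSum_coeff_exp_mul_pow
    hf0.aestronglyMeasurable (hf _)
  simp only [h, mul_zero] at hsum
  simpa only [mul_right_comm] using hsum.unique hasSum_zero

theorem exists_norm_eval_le_mul_exp_abs (p : ℂ[X]) :
    ∃ C : ℝ, ∀ t : ℝ, ‖p.eval (t : ℂ)‖ ≤ C * Real.exp |t| := by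
  induction p using Polynomial.induction_on' with
  | add p q hp hq =>
    obtain ⟨C, hC⟩ := hp
    obtain ⟨D, hD⟩ := hq
    refine ⟨C + D, fun t => ?_⟩
    rw [Polynomial.eval_add, add_mul]
    exact norm_add_le_of_le (hC t) (hD t)
  | monomial n c =>
    refine ⟨‖c‖ * n !, fun t => ?_⟩
    rw [Polynomial.eval_monomial, norm_mul, norm_pow, Complex.norm_real, Real.norm_eq_abs,
      mul_assoc]
    gcongr
    rw [← div_le_iff₀' (by positivity)]
    exact Real.pow_div_factorial_le_exp _ (abs_nonneg t) n

/-- The function `t ↦ exp (-a t²) p(t)`. These functions make up `gaussSpan a`. -/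
def polyGauss (a : ℝ) : ℂ[X] →ₗ[ℂ] (ℝ → ℂ) where
  toFun p t := Real.exp (-(a * t ^ 2)) * p.eval (t : ℂ)
  map_add' p q := by ext; simp [mul_add]
  map_smul' c p := by ext; simp [mul_left_comm]

theorem polyGauss_apply (a : ℝ) (p : ℂ[X]) (t : ℝ) :
    polyGauss a p t = Real.exp (-(a * t ^ 2)) * p.eval (t : ℂ) := rfl

theorem continuous_polyGauss (a : ℝ) (p : ℂ[X]) : Continuous (polyGauss a p) := by
  have : Continuous fun t : ℝ => Real.exp (-(a * t ^ 2)) * p.eval (t : ℂ) := by fun_prop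
  exact this

theorem gaussSpan_eq_range (a : ℝ) : gaussSpan a = LinearMap.range (polyGauss a) := by
  rw [LinearMap.range_eq_map, ← (Polynomial.basisMonomials ℂ).span_eq, Submodule.map_span,
    ← Set.range_comp, gaussSpan]
  congr 2
  ext n t
  simp [polyGauss_apply]

theorem exists_norm_polyGauss_le (a : ℝ) (p : ℂ[X]) :
    ∃ C : ℝ, ∀ t, ‖polyGauss a p t‖ ≤ C * (Real.exp (1 * |t|) * Real.exp (-(a * t ^ 2))) := by
  obtain ⟨C, hC⟩ := exists_norm_eval_le_mul_exp_abs p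
  refine ⟨C, fun t => ?_⟩
  rw [polyGauss_apply, norm_mul, Complex.norm_real, Real.norm_of_nonneg (Real.exp_pos _).le,
    one_mul, mul_comm, ← mul_assoc]
  exact mul_le_mul_of_nonneg_right (hC t) (Real.exp_pos _).le

theorem memLp_polyGauss (hμ : -(1 / 2 : ℝ) < μ) {a : ℝ} (ha : 0 < a) (p : ℂ[X]) :
    MemLp (polyGauss a p) 2 (weightMeasure μ) := by
  obtain ⟨C, hC⟩ := exists_norm_polyGauss_le a p
  exact ((memLp_exp_abs_mul_gaussian hμ ha 1).const_mul C).mono'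
    (continuous_polyGauss a p).aestronglyMeasurable (Filter.Eventually.of_forall hC)

theorem integrable_exp_abs_smul_polyGauss (hμ : -(1 / 2 : ℝ) < μ) {a : ℝ} (ha : 0 < a) (c : ℝ)
    (p : ℂ[X]) : Integrable (fun t => Real.exp (c * |t|) • polyGauss a p t) (weightMeasure μ) := by
  obtain ⟨C, hC⟩ := exists_norm_polyGauss_le a p
  refine ((integrable_exp_abs_mul_gaussian hμ ha (c + 1)).const_mul C).mono'
    ((by fun_prop : Continuous fun t : ℝ => Real.exp (c * |t|)).smul
      (continuous_polyGauss a p)).aestronglyMeasurable (Filter.Eventually.of_forall fun t => ?_)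
  rw [norm_smul, Real.norm_of_nonneg (Real.exp_pos _).le, add_mul, Real.exp_add, mul_assoc,
    mul_left_comm]
  exact mul_le_mul_of_nonneg_left (hC t) (Real.exp_pos _).le

/-- `polyGauss a p` as an element of `L2w μ`. -/
def polyGaussLp (hμ : -(1 / 2 : ℝ) < μ) {a : ℝ} (ha : 0 < a) : ℂ[X] →ₗ[ℂ] L2w μ where
  toFun p := (memLp_polyGauss hμ ha p).toLp (polyGauss a p)
  map_add' p q := by simp only [map_add]; rfl
  map_smul' c p := by simp only [map_smul]; rfl

theorem coeFn_polyGaussLp (hμ : -(1 / 2 : ℝ) < μ) {a : ℝ} (ha : 0 < a) (p : ℂ[X]) :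
    polyGaussLp hμ ha p =ᵐ[weightMeasure μ] polyGauss a p :=
  (memLp_polyGauss hμ ha p).coeFn_toLp

theorem eq_zero_of_forall_inner_polyGaussLp_eq_zero (hμ : -(1 / 2 : ℝ) < μ) {a : ℝ} (ha : 0 < a)
    {v : L2w μ} (hv : ∀ p, inner ℂ (polyGaussLp hμ ha p) v = 0) : v = 0 := by
  have hmoment : ∀ n : ℕ,
      ∫ t, (t : ℂ) ^ n * (Real.exp (-(a * t ^ 2)) * v t) ∂(weightMeasure μ) = 0 := fun n => by
    rw [← hv (Polynomial.X ^ n), L2.inner_def]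
    refine integral_congr_ae ?_
    filter_upwards [coeFn_polyGaussLp hμ ha (Polynomial.X ^ n)] with t ht
    simp only [ht, polyGauss_apply, RCLike.inner_apply, map_mul, Complex.conj_ofReal,
      Polynomial.eval_pow, Polynomial.eval_X, map_pow]
    ring
  have hint : ∀ c : ℝ, Integrable
      (fun t => Real.exp (c * |t|) • ((Real.exp (-(a * t ^ 2)) : ℂ) * v t)) (weightMeasure μ) :=
    fun c => by
      have := (memLp_exp_abs_mul_gaussian hμ ha c).ofReal (K := ℂ) |>.integrable_mul (Lp.memLp v)
      simpa [Pi.mul_def, mul_assoc] using this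
  refine Lp.ext ?_
  filter_upwards [ae_eq_zero_of_forall_integral_pow_mul_eq_zero hint hmoment,
    Lp.coeFn_zero ℂ 2 (weightMeasure μ)] with t ht h0
  rw [h0]
  simpa using ht

theorem topologicalClosure_span_range_polyGaussLp (hμ : -(1 / 2 : ℝ) < μ) {a : ℝ} (ha : 0 < a)
    {ι : Type*} {P : ι → ℂ[X]} (hP : Submodule.span ℂ (Set.range P) = ⊤) :
    (Submodule.span ℂ (Set.range fun i => polyGaussLp hμ ha (P i))).topologicalClosure = ⊤ := by
  have hspan : Submodule.span ℂ (Set.range fun i => polyGaussLp hμ ha (P i)) =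
      LinearMap.range (polyGaussLp hμ ha) := by
    rw [LinearMap.range_eq_map, ← hP, Submodule.map_span, ← Set.range_comp, Function.comp_def]
  rw [hspan, Submodule.topologicalClosure_eq_top_iff, Submodule.eq_bot_iff]
  exact fun v hv => eq_zero_of_forall_inner_polyGaussLp_eq_zero hμ ha fun p =>
    hv _ (LinearMap.mem_range_self _ p)

/-! ### Generalized Hermite functions -/

/-- The Dunkl operator with parameter `μ` on polynomials. -/
def dunklOp (μ : ℝ) : ℂ[X] →ₗ[ℂ] ℂ[X] :=
  Polynomial.lsum fun n => (dunklCoeff μ n : ℂ) • Polynomial.monomial (n - 1)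

theorem dunklOp_monomial (μ : ℝ) (n : ℕ) (c : ℂ) :
    dunklOp μ (Polynomial.monomial n c) = Polynomial.monomial (n - 1) (dunklCoeff μ n * c) := by
  simp [dunklOp, Polynomial.smul_monomial]

theorem dunklOp_one (μ : ℝ) : dunklOp μ 1 = 0 := by
  simpa [dunklCoeff_zero] using dunklOp_monomial μ 0 1

theorem coeff_dunklOp (μ : ℝ) (p : ℂ[X]) (k : ℕ) :
    (dunklOp μ p).coeff k = dunklCoeff μ (k + 1) * p.coeff (k + 1) := by
  induction p using Polynomial.induction_on' with
  | add p q hp hq => simp only [map_add, Polynomial.coeff_add, hp, hq, mul_add]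
  | monomial n c =>
    cases n with
    | zero =>
      rw [dunklOp_monomial]
      simp [dunklCoeff_zero, Polynomial.coeff_C_succ]
    | succ n =>
      rw [dunklOp_monomial, Nat.add_sub_cancel, Polynomial.coeff_monomial,
        Polynomial.coeff_monomial]
      by_cases h : n = k <;> simp [h]

theorem coe_dunklOp (μ : ℝ) (p : ℂ[X]) :
    (dunklOp μ p : ℂ⟦X⟧) = dunklSeries μ (p : ℂ⟦X⟧) := by
  ext n
  simp [coeff_dunklOp]

theorem dunklOp_mul_of_even (μ : ℝ) (p : ℂ[X]) {q : ℂ[X]} (hq : ∀ n, ¬ Even n → q.coeff n = 0) :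
    dunklOp μ (p * q) = dunklOp μ p * q + p * dunklOp μ q := by
  refine Polynomial.coe_injective ℂ ?_
  simp only [Polynomial.coe_add, Polynomial.coe_mul, coe_dunklOp]
  exact dunklSeries_mul_of_even μ _ fun n hn => by rw [Polynomial.coeff_coe, hq n hn]

theorem coeff_dunklOp_iterate (hμ : -(1 / 2 : ℝ) < μ) (m : ℕ) (p : ℂ[X]) (k : ℕ) :
    genFactorial μ k * ((dunklOp μ)^[m] p).coeff k =
      genFactorial μ (k + m) * p.coeff (k + m) := by
  induction m generalizing k with
  | zero => rfl
  | succ m ih =>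
    rw [Function.iterate_succ_apply', coeff_dunklOp, ← add_assoc, add_right_comm k, ← ih,
      genFactorial_succ hμ k]
    push_cast
    ring

theorem dunklOp_iterate_of_natDegree_le (hμ : -(1 / 2 : ℝ) < μ) {n : ℕ} {p : ℂ[X]}
    (hp : p.natDegree ≤ n) :
    (dunklOp μ)^[n] p = Polynomial.monomial 0 (genFactorial μ n * p.coeff n) := by
  ext k
  refine mul_left_cancel₀ (Complex.ofReal_ne_zero.2 (genFactorial_pos hμ k).ne') ?_
  rw [coeff_dunklOp_iterate hμ, Polynomial.coeff_monomial]
  cases k with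
  | zero => simp [genFactorial_zero hμ]
  | succ k => simp [Polynomial.coeff_eq_zero_of_natDegree_lt (by omega : p.natDegree < k + 1 + n)]

theorem integrable_polyGauss (hμ : -(1 / 2 : ℝ) < μ) {a : ℝ} (ha : 0 < a) (p : ℂ[X]) :
    Integrable (polyGauss a p) (weightMeasure μ) := by
  simpa using integrable_exp_abs_smul_polyGauss hμ ha 0 p

/-- Integration of polynomials against `exp (-a t²) |t|^(2μ) dt`. -/
def gaussIntegral (hμ : -(1 / 2 : ℝ) < μ) {a : ℝ} (ha : 0 < a) : ℂ[X] →ₗ[ℂ] ℂ where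
  toFun p := ∫ t, polyGauss a p t ∂(weightMeasure μ)
  map_add' p q := by
    rw [map_add]
    exact integral_add (integrable_polyGauss hμ ha p) (integrable_polyGauss hμ ha q)
  map_smul' c p := by
    rw [map_smul]
    exact integral_smul c _

theorem gaussIntegral_apply (hμ : -(1 / 2 : ℝ) < μ) {a : ℝ} (ha : 0 < a) (p : ℂ[X]) :
    gaussIntegral hμ ha p = ∫ t, polyGauss a p t ∂(weightMeasure μ) := rfl

theorem gaussIntegral_monomial (hμ : -(1 / 2 : ℝ) < μ) {a : ℝ} (ha : 0 < a) (n : ℕ) (c : ℂ) :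
    gaussIntegral hμ ha (Polynomial.monomial n c) = c * gaussMoment μ a n := by
  rw [gaussIntegral_apply, gaussMoment, ← integral_complex_ofReal, ← integral_const_mul]
  refine integral_congr_ae (Filter.Eventually.of_forall fun t => ?_)
  simp only [polyGauss_apply, Polynomial.eval_monomial]
  push_cast
  ring

theorem gaussIntegral_dunklOp (hμ : -(1 / 2 : ℝ) < μ) {a : ℝ} (ha : 0 < a) (p : ℂ[X]) :
    gaussIntegral hμ ha (dunklOp μ p) = 2 * a * gaussIntegral hμ ha (Polynomial.X * p) := by
  induction p using Polynomial.induction_on' with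
  | add p q hp hq => simp only [map_add, mul_add, hp, hq]
  | monomial n c =>
    rw [dunklOp_monomial, Polynomial.X_mul_monomial, gaussIntegral_monomial,
      gaussIntegral_monomial]
    cases n with
    | zero => simp [dunklCoeff_zero, gaussMoment_of_odd μ a odd_one]
    | succ n =>
      have hmoment : 2 * (a : ℂ) * gaussMoment μ a (n + 2) =
          dunklCoeff μ (n + 1) * gaussMoment μ a n := by
        exact_mod_cast gaussMoment_add_two hμ ha n
      rw [Nat.add_sub_cancel]
      linear_combination (-c) * hmoment

theorem gaussIntegral_dunklOp_mul_add (hμ : -(1 / 2 : ℝ) < μ) {a : ℝ} (ha : 0 < a) (p q : ℂ[X]) :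
    gaussIntegral hμ ha (dunklOp μ p * q) + gaussIntegral hμ ha (p * dunklOp μ q) =
      2 * a * gaussIntegral hμ ha (Polynomial.X * (p * q)) := by
  have hleibniz : ∀ r : ℂ[X], ∀ {m : ℕ} (c : ℂ), Even m →
      dunklOp μ (r * Polynomial.monomial m c) =
        dunklOp μ r * Polynomial.monomial m c + r * dunklOp μ (Polynomial.monomial m c) :=
    fun r m c hm => dunklOp_mul_of_even μ r fun n hn => by
      rw [Polynomial.coeff_monomial_of_ne _ (by rintro rfl; exact hn hm)]
  induction p using Polynomial.induction_on' with
  | add p p' hp hp' => simp only [map_add, add_mul, mul_add]; linear_combination hp + hp'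
  | monomial n c =>
  induction q using Polynomial.induction_on' with
  | add q q' hq hq' => simp only [map_add, mul_add]; linear_combination hq + hq'
  | monomial m c' =>
  rcases Nat.even_or_odd m with hm | hm
  · rw [← map_add, ← hleibniz _ _ hm, gaussIntegral_dunklOp]
  rcases Nat.even_or_odd n with hn | hn
  · rw [← map_add, add_comm, mul_comm (Polynomial.monomial n c),
      mul_comm (dunklOp μ (Polynomial.monomial n c)), ← hleibniz _ _ hn, gaussIntegral_dunklOp,
      mul_comm (Polynomial.monomial n c)]
  · have hodd : Odd (n - 1 + m) ∧ Odd (n + (m - 1)) ∧ Odd (n + m + 1) := by grind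
    simp only [dunklOp_monomial, Polynomial.X_mul_monomial, Polynomial.monomial_mul_monomial,
      gaussIntegral_monomial, gaussMoment_of_odd μ a hodd.1, gaussMoment_of_odd μ a hodd.2.1,
      gaussMoment_of_odd μ a hodd.2.2]
    simp

/-- The generalized Hermite polynomials, scaled to have leading coefficient `2ⁿ`. -/
def hermitePoly (μ : ℝ) : ℕ → ℂ[X]
  | 0 => 1
  | n + 1 => 2 * Polynomial.X * hermitePoly μ n - dunklOp μ (hermitePoly μ n)

theorem coeff_hermitePoly_succ (μ : ℝ) (n j : ℕ) :
    (hermitePoly μ (n + 1)).coeff j =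
      2 * (Polynomial.X * hermitePoly μ n).coeff j -
        dunklCoeff μ (j + 1) * (hermitePoly μ n).coeff (j + 1) := by
  rw [hermitePoly, Polynomial.coeff_sub, coeff_dunklOp, mul_assoc, ← Polynomial.C_ofNat,
    Polynomial.coeff_C_mul]

theorem coeff_hermitePoly_eq_zero (μ : ℝ) {n j : ℕ} (h : n < j ∨ Odd (n + j)) :
    (hermitePoly μ n).coeff j = 0 := by
  induction n generalizing j with
  | zero => simp [hermitePoly, Polynomial.coeff_one, show j ≠ 0 by grind]
  | succ n ih =>
    rw [coeff_hermitePoly_succ, ih (j := j + 1) (by grind)]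
    cases j with
    | zero => simp
    | succ j => simp [ih (j := j) (by grind)]

theorem coeff_hermitePoly (hμ : -(1 / 2 : ℝ) < μ) {n i j : ℕ} (h : j + 2 * i = n) :
    (i ! * genFactorial μ j : ℂ) * (hermitePoly μ n).coeff j =
      (-1) ^ i * 2 ^ j * genFactorial μ n := by
  induction n generalizing i j with
  | zero =>
    obtain ⟨rfl, rfl⟩ : j = 0 ∧ i = 0 := by omega
    simp [hermitePoly]
  | succ n ih =>
    have hraise : (i ! * genFactorial μ j : ℂ) * (2 * (Polynomial.X * hermitePoly μ n).coeff j) =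
        dunklCoeff μ j * ((-1) ^ i * 2 ^ j * genFactorial μ n) := by
      cases j with
      | zero => simp [dunklCoeff_zero]
      | succ j =>
        rw [Polynomial.coeff_X_mul, genFactorial_succ hμ j]
        push_cast
        linear_combination (2 * dunklCoeff μ (j + 1) : ℂ) * ih (i := i) (j := j) (by omega)
    have hlower : (i ! * genFactorial μ j : ℂ) *
        (dunklCoeff μ (j + 1) * (hermitePoly μ n).coeff (j + 1)) =
          -(2 * i * ((-1) ^ i * 2 ^ j * genFactorial μ n)) := by
      cases i with
      | zero => simp [coeff_hermitePoly_eq_zero μ (n := n) (j := j + 1) (by omega)]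
      | succ i =>
        have := ih (i := i) (j := j + 1) (by omega)
        rw [genFactorial_succ hμ j] at this
        rw [Nat.factorial_succ]
        push_cast at this ⊢
        linear_combination (i + 1 : ℂ) * this
    rw [coeff_hermitePoly_succ, mul_sub, hraise, hlower, genFactorial_succ hμ n, ← h,
      dunklCoeff_add_of_even μ j (even_two_mul i)]
    push_cast
    ring

theorem coeff_hermitePoly_self (hμ : -(1 / 2 : ℝ) < μ) (n : ℕ) :
    (hermitePoly μ n).coeff n = 2 ^ n := by
  refine mul_left_cancel₀ (Complex.ofReal_ne_zero.2 (genFactorial_pos hμ n).ne') ?_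
  simpa [mul_comm] using coeff_hermitePoly hμ (i := 0) (add_zero n)

theorem degree_hermitePoly (hμ : -(1 / 2 : ℝ) < μ) (n : ℕ) : (hermitePoly μ n).degree = n := by
  refine le_antisymm ?_ (Polynomial.le_degree_of_ne_zero ?_)
  · rw [Polynomial.degree_le_iff_coeff_zero]
    exact fun j hj => coeff_hermitePoly_eq_zero μ (Or.inl (by exact_mod_cast hj))
  · rw [coeff_hermitePoly_self hμ]
    exact pow_ne_zero _ two_ne_zero

theorem hermitePoly_eq_sum (hμ : -(1 / 2 : ℝ) < μ) (n : ℕ) :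
    hermitePoly μ n = ∑ i ∈ Finset.range (n / 2 + 1), Polynomial.monomial (n - 2 * i)
      ((-1) ^ i * 2 ^ (n - 2 * i) * genFactorial μ n / (i ! * genFactorial μ (n - 2 * i)) : ℂ) := by
  ext j
  simp only [Polynomial.finsetSum_coeff, Polynomial.coeff_monomial]
  by_cases h : ∃ i, j + 2 * i = n
  · obtain ⟨i, hi⟩ := h
    have hne : (i ! * genFactorial μ j : ℂ) ≠ 0 :=
      mul_ne_zero (by exact_mod_cast i.factorial_ne_zero)
        (Complex.ofReal_ne_zero.2 (genFactorial_pos hμ j).ne')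
    rw [Finset.sum_eq_single_of_mem i (Finset.mem_range.2 (by omega)) fun k hk hki =>
      if_neg (by have := Finset.mem_range.1 hk; omega), if_pos (by omega),
      show n - 2 * i = j by omega, eq_div_iff hne, mul_comm, coeff_hermitePoly hμ hi]
  · rw [coeff_hermitePoly_eq_zero μ, Finset.sum_eq_zero]
    swap
    · by_contra hj
      exact h ⟨(n - j) / 2, by grind⟩
    exact fun i hi => if_neg fun hj => h ⟨i, by have := Finset.mem_range.1 hi; omega⟩

theorem genHermite_eq_sum (hμ : -(1 / 2 : ℝ) < μ) (n : ℕ) (x : ℝ) :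
    genHermite μ n x = n ! * ∑ i ∈ Finset.range (n / 2 + 1),
      (-1) ^ i * 2 ^ (n - 2 * i) / (i ! * genFactorial μ (n - 2 * i)) * x ^ (n - 2 * i) := by
  have hΓ := (gamma_half_pos hμ).ne'
  have hterm : ∀ (k i e : ℕ) {N B y : ℝ}, 0 < B →
      (-1) ^ (k + i) * (N / (k + i)!) *
          ((-1) ^ k * ((k + i).choose k : ℝ) * (Real.Gamma (μ + 1 / 2) / B) * y) =
        N * ((-1) ^ i * 2 ^ e / (i ! * (2 ^ e * k ! * B / Real.Gamma (μ + 1 / 2))) * y) := by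
    intro k i e N B y hB
    have hsign : ((-1 : ℝ) ^ k) * (-1) ^ k = 1 := by rw [← mul_pow]; simp
    rw [Nat.cast_choose ℝ (Nat.le_add_right k i), Nat.add_sub_cancel_left, pow_add (-1 : ℝ)]
    generalize Real.Gamma (μ + 1 / 2) = A at *
    field_simp
    linear_combination N * y * hsign
  have hpos : ∀ {k : ℕ} {c : ℝ}, 1 / 2 ≤ c → 0 < Real.Gamma (k + μ + c) := fun {k c} hc =>
    Real.Gamma_pos_of_pos (by have : (0 : ℝ) ≤ k := k.cast_nonneg; linarith)
  rcases Nat.even_or_odd' n with ⟨m, rfl | rfl⟩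
  · rw [← Finset.sum_flip, Finset.mul_sum, genHermite, if_pos (even_two_mul m), Finset.mul_sum,
      Nat.mul_div_cancel_left m two_pos]
    refine Finset.sum_congr rfl fun k hk => ?_
    obtain ⟨i, rfl⟩ := Nat.exists_eq_add_of_le (Finset.mem_range_succ_iff.1 hk)
    rw [Nat.add_sub_cancel_left, show 2 * (k + i) - 2 * i = 2 * k by omega, genFactorial_two_mul]
    exact hterm k i _ (hpos le_rfl)
  · rw [← Finset.sum_flip, Finset.mul_sum, genHermite, if_neg (by simp), Finset.mul_sum,
      show (2 * m + 1) / 2 = m by omega]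
    refine Finset.sum_congr rfl fun k hk => ?_
    obtain ⟨i, rfl⟩ := Nat.exists_eq_add_of_le (Finset.mem_range_succ_iff.1 hk)
    rw [Nat.add_sub_cancel_left, show 2 * (k + i) + 1 - 2 * i = 2 * k + 1 by omega,
      genFactorial_two_mul_add_one]
    exact hterm k i _ (hpos (by norm_num))

theorem eval_hermitePoly (hμ : -(1 / 2 : ℝ) < μ) (n : ℕ) (x : ℝ) :
    (hermitePoly μ n).eval (x : ℂ) = ((genFactorial μ n / n ! * genHermite μ n x : ℝ) : ℂ) := by
  have hn : (n ! : ℝ) ≠ 0 := by exact_mod_cast n.factorial_ne_zero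
  rw [hermitePoly_eq_sum hμ, Polynomial.eval_finsetSum, genHermite_eq_sum hμ, ← mul_assoc,
    div_mul_cancel₀ _ hn, Finset.mul_sum, Complex.ofReal_sum]
  refine Finset.sum_congr rfl fun i _ => ?_
  rw [Polynomial.eval_monomial]
  push_cast
  ring

theorem gaussIntegral_hermitePoly_mul (hμ : -(1 / 2 : ℝ) < μ) (n : ℕ) (p : ℂ[X]) :
    gaussIntegral hμ one_pos (hermitePoly μ n * p) =
      gaussIntegral hμ one_pos ((dunklOp μ)^[n] p) := by
  induction n generalizing p with
  | zero => simp [hermitePoly]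
  | succ n ih =>
    have hparts := gaussIntegral_dunklOp_mul_add hμ one_pos (hermitePoly μ n) p
    rw [Complex.ofReal_one, mul_one, two_mul, ← map_add, ← two_mul] at hparts
    rw [Function.iterate_succ_apply, ← ih, hermitePoly, sub_mul, map_sub, mul_assoc, mul_assoc,
      two_mul, map_add, ← two_mul, ← hparts, map_add, add_sub_cancel_left]

theorem gaussIntegral_hermitePoly_mul_of_natDegree_le (hμ : -(1 / 2 : ℝ) < μ) {n : ℕ} {p : ℂ[X]}
    (hp : p.natDegree ≤ n) :
    gaussIntegral hμ one_pos (hermitePoly μ n * p) =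
      genFactorial μ n * Real.Gamma (μ + 1 / 2) * p.coeff n := by
  rw [gaussIntegral_hermitePoly_mul hμ, dunklOp_iterate_of_natDegree_le hμ hp,
    gaussIntegral_monomial, gaussMoment_zero hμ one_pos, Real.one_rpow, one_mul]
  ring

theorem gaussIntegral_hermitePoly_mul_hermitePoly (hμ : -(1 / 2 : ℝ) < μ) (m n : ℕ) :
    gaussIntegral hμ one_pos (hermitePoly μ m * hermitePoly μ n) =
      if m = n then (2 ^ n * genFactorial μ n * Real.Gamma (μ + 1 / 2) : ℂ) else 0 := by
  have hdeg : ∀ k, (hermitePoly μ k).natDegree = k := fun k =>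
    Polynomial.natDegree_eq_of_degree_eq_some (degree_hermitePoly hμ k)
  rcases lt_trichotomy m n with h | rfl | h
  · rw [mul_comm, gaussIntegral_hermitePoly_mul_of_natDegree_le hμ ((hdeg m).trans_le h.le),
      coeff_hermitePoly_eq_zero μ (Or.inl h), mul_zero, if_neg h.ne]
  · rw [gaussIntegral_hermitePoly_mul_of_natDegree_le hμ (hdeg m).le, coeff_hermitePoly_self hμ,
      if_pos rfl]
    ring
  · rw [gaussIntegral_hermitePoly_mul_of_natDegree_le hμ ((hdeg n).trans_le h.le),
      coeff_hermitePoly_eq_zero μ (Or.inl h), mul_zero, if_neg h.ne']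

/-- The coefficient of `hermitePoly μ n` in the generalized Hermite function `hermiteFun μ n`. -/
def hermiteConst (μ : ℝ) (n : ℕ) : ℝ :=
  √(genFactorial μ n / Real.Gamma (μ + 1 / 2)) / (2 ^ ((n : ℝ) / 2) * genFactorial μ n)

theorem hermiteConst_sq_mul (hμ : -(1 / 2 : ℝ) < μ) (n : ℕ) :
    hermiteConst μ n ^ 2 * (2 ^ n * genFactorial μ n * Real.Gamma (μ + 1 / 2)) = 1 := by
  have hγ := genFactorial_pos hμ n
  have hΓ := gamma_half_pos hμ
  have htwo : ((2 : ℝ) ^ ((n : ℝ) / 2)) ^ 2 = 2 ^ n := by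
    rw [← Real.rpow_mul_natCast zero_le_two, ← Real.rpow_natCast]
    congr 1
    push_cast
    ring
  rw [hermiteConst, div_pow, Real.sq_sqrt (by positivity), mul_pow, htwo]
  generalize Real.Gamma (μ + 1 / 2) = A at *
  field_simp

theorem hermiteConst_ne_zero (hμ : -(1 / 2 : ℝ) < μ) (n : ℕ) : hermiteConst μ n ≠ 0 := fun h => by
  simpa [h] using hermiteConst_sq_mul hμ n

/-- The polynomial factor of the generalized Hermite function `hermiteFun μ n`. -/
def normHermitePoly (μ : ℝ) (n : ℕ) : ℂ[X] := (hermiteConst μ n : ℂ) • hermitePoly μ n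

theorem hermiteFun_eq_polyGauss (hμ : -(1 / 2 : ℝ) < μ) (n : ℕ) :
    hermiteFun μ n = polyGauss (1 / 2) (normHermitePoly μ n) := by
  ext x
  have hγ := (genFactorial_pos hμ n).ne'
  rw [polyGauss_apply, normHermitePoly, Polynomial.eval_smul, eval_hermitePoly hμ, smul_eq_mul,
    hermiteFun, ← Complex.ofReal_mul, ← Complex.ofReal_mul, hermiteConst]
  congr 1
  rw [show -(x ^ 2) / 2 = -(1 / 2 * x ^ 2) by ring]
  field_simp

theorem span_range_normHermitePoly (hμ : -(1 / 2 : ℝ) < μ) :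
    Submodule.span ℂ (Set.range (normHermitePoly μ)) = ⊤ := by
  have hdeg : ∀ n, (normHermitePoly μ n).degree = n := fun n => by
    rw [normHermitePoly, Polynomial.smul_eq_C_mul,
      Polynomial.degree_C_mul (Complex.ofReal_ne_zero.2 (hermiteConst_ne_zero hμ n)),
      degree_hermitePoly hμ]
  let S : Polynomial.Sequence ℂ := ⟨normHermitePoly μ, hdeg⟩
  exact S.span fun n => (Polynomial.leadingCoeff_ne_zero.2 (S.ne_zero n)).isUnit

theorem memLp_hermiteFun (hμ : -(1 / 2 : ℝ) < μ) (n : ℕ) :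
    MemLp (hermiteFun μ n) 2 (weightMeasure μ) := by
  rw [hermiteFun_eq_polyGauss hμ]
  exact memLp_polyGauss hμ one_half_pos _

theorem toLp_hermiteFun (hμ : -(1 / 2 : ℝ) < μ) (n : ℕ) :
    (memLp_hermiteFun hμ n).toLp (hermiteFun μ n) =
      polyGaussLp hμ one_half_pos (normHermitePoly μ n) :=
  MemLp.toLp_congr _ (memLp_polyGauss hμ one_half_pos _)
    (Filter.EventuallyEq.of_eq (hermiteFun_eq_polyGauss hμ n))

theorem integral_hermiteFun_mul_hermiteFun (hμ : -(1 / 2 : ℝ) < μ) (m n : ℕ) :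
    ∫ t, hermiteFun μ m t * hermiteFun μ n t ∂(weightMeasure μ) =
      hermiteConst μ m * hermiteConst μ n *
        gaussIntegral hμ one_pos (hermitePoly μ m * hermitePoly μ n) := by
  rw [gaussIntegral_apply, ← integral_const_mul]
  refine integral_congr_ae (Filter.Eventually.of_forall fun t => ?_)
  have hexp : Real.exp (-(1 * t ^ 2)) =
      Real.exp (-(1 / 2 * t ^ 2)) * Real.exp (-(1 / 2 * t ^ 2)) := by
    rw [← Real.exp_add]
    congr 1
    ring
  simp only [hermiteFun_eq_polyGauss hμ, polyGauss_apply, normHermitePoly, Polynomial.eval_smul,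
    Polynomial.eval_mul, hexp, smul_eq_mul]
  push_cast
  ring

theorem orthonormal_hermiteFun (hμ : -(1 / 2 : ℝ) < μ) :
    Orthonormal ℂ fun n => (memLp_hermiteFun hμ n).toLp (hermiteFun μ n) := by
  rw [orthonormal_iff_ite]
  intro m n
  have hinner : inner ℂ ((memLp_hermiteFun hμ m).toLp (hermiteFun μ m))
      ((memLp_hermiteFun hμ n).toLp (hermiteFun μ n)) =
        ∫ t, hermiteFun μ m t * hermiteFun μ n t ∂(weightMeasure μ) := by
    rw [L2.inner_def]
    refine integral_congr_ae ?_
    filter_upwards [(memLp_hermiteFun hμ m).coeFn_toLp, (memLp_hermiteFun hμ n).coeFn_toLp]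
      with t hm hn
    rw [hm, hn, RCLike.inner_apply, mul_comm, hermiteFun, Complex.conj_ofReal]
  rw [hinner, integral_hermiteFun_mul_hermiteFun hμ, gaussIntegral_hermitePoly_mul_hermitePoly]
  split_ifs with h
  · subst h
    rw [← sq]
    exact_mod_cast hermiteConst_sq_mul hμ m
  · rw [mul_zero]

theorem topologicalClosure_span_hermiteFun (hμ : -(1 / 2 : ℝ) < μ) :
    (Submodule.span ℂ (Set.range fun n =>
      (memLp_hermiteFun hμ n).toLp (hermiteFun μ n))).topologicalClosure = ⊤ := by
  simp only [toLp_hermiteFun hμ]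
  exact topologicalClosure_span_range_polyGaussLp hμ _ (span_range_normHermitePoly hμ)

/-! ### The transform of the generalized Hermite functions -/

/-- The power series of `exp (-x² / 2)`. -/
def gaussSeries : ℂ⟦X⟧ :=
  PowerSeries.mk fun n => if Even n then (-1 / 2) ^ (n / 2) / ((n / 2)! : ℂ) else 0

theorem coeff_gaussSeries_two_mul (m : ℕ) :
    PowerSeries.coeff (2 * m) gaussSeries = (-1 / 2) ^ m / (m ! : ℂ) := by
  simp [gaussSeries]

theorem coeff_gaussSeries_of_not_even (n : ℕ) (hn : ¬ Even n) :
    PowerSeries.coeff n gaussSeries = 0 := by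
  simp [gaussSeries, hn]

theorem hasSum_coeff_gaussSeries_mul_pow (x : ℝ) :
    HasSum (fun n => PowerSeries.coeff n gaussSeries * (x : ℂ) ^ n)
      (Real.exp (-(1 / 2 * x ^ 2)) : ℂ) := by
  have heven : HasSum (fun m => PowerSeries.coeff (2 * m) gaussSeries * (x : ℂ) ^ (2 * m))
      (Real.exp (-(1 / 2 * x ^ 2)) : ℂ) := by
    have hexp := NormedSpace.expSeries_div_hasSum_exp (-(1 / 2 * (x : ℂ) ^ 2))
    rw [← Complex.exp_eq_exp_ℂ] at hexp
    push_cast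
    refine hexp.congr_fun fun m => ?_
    rw [coeff_gaussSeries_two_mul, show -(1 / 2 * (x : ℂ) ^ 2) = -1 / 2 * x ^ 2 by ring, mul_pow,
      ← pow_mul, mul_div_right_comm]
  refine ((mul_right_injective₀ two_ne_zero).hasSum_iff fun n hn => ?_).1 heven
  rw [coeff_gaussSeries_of_not_even n fun h => hn (h.two_dvd.imp fun _ => Eq.symm), zero_mul]

theorem dunklSeries_gaussSeries (μ : ℝ) :
    dunklSeries μ gaussSeries = -PowerSeries.X * gaussSeries := by
  ext n
  rw [coeff_dunklSeries, neg_mul, map_neg]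
  rcases Nat.even_or_odd' n with ⟨m, rfl | rfl⟩
  · rw [coeff_gaussSeries_of_not_even _ (by simp)]
    cases m with
    | zero => simp
    | succ m =>
      rw [show 2 * (m + 1) = 2 * m + 1 + 1 by ring, PowerSeries.coeff_succ_X_mul,
        coeff_gaussSeries_of_not_even _ (by simp)]
      simp
  · rw [show 2 * m + 1 + 1 = 2 * (m + 1) by ring, dunklCoeff_of_even μ (even_two_mul _),
      PowerSeries.coeff_succ_X_mul, coeff_gaussSeries_two_mul, coeff_gaussSeries_two_mul,
      Nat.factorial_succ, pow_succ]
    have hm : (m : ℂ) + 1 ≠ 0 := m.cast_add_one_ne_zero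
    have hfact : (m ! : ℂ) ≠ 0 := Nat.cast_ne_zero.2 m.factorial_ne_zero
    push_cast
    field_simp

theorem dunklSeries_coe_mul_gaussSeries (μ : ℝ) (p : ℂ[X]) :
    dunklSeries μ ((p : ℂ⟦X⟧) * gaussSeries) =
      (dunklOp μ p : ℂ⟦X⟧) * gaussSeries - PowerSeries.X * ((p : ℂ⟦X⟧) * gaussSeries) := by
  rw [dunklSeries_mul_of_even μ _ coeff_gaussSeries_of_not_even, dunklSeries_gaussSeries,
    coe_dunklOp]
  ring

/-- The power series in `x` of `∫ e_μ(ωxt) exp (-a t²) p(t) |t|^(2μ) dt`. -/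
def transformSeries (hμ : -(1 / 2 : ℝ) < μ) {a : ℝ} (ha : 0 < a) (ω : ℂ) : ℂ[X] →ₗ[ℂ] ℂ⟦X⟧ where
  toFun p := PowerSeries.mk fun n =>
    (genFactorial μ n : ℂ)⁻¹ * ω ^ n * gaussIntegral hμ ha (Polynomial.X ^ n * p)
  map_add' p q := by ext; simp [mul_add]
  map_smul' c p := by ext; simp [mul_left_comm]

theorem coeff_transformSeries (hμ : -(1 / 2 : ℝ) < μ) {a : ℝ} (ha : 0 < a) (ω : ℂ) (p : ℂ[X])
    (n : ℕ) :
    PowerSeries.coeff n (transformSeries hμ ha ω p) =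
      (genFactorial μ n : ℂ)⁻¹ * ω ^ n * gaussIntegral hμ ha (Polynomial.X ^ n * p) := by
  simp [transformSeries]

theorem dunklCoeff_mul_inv_genFactorial (hμ : -(1 / 2 : ℝ) < μ) (n : ℕ) :
    (dunklCoeff μ (n + 1) : ℂ) * (genFactorial μ (n + 1) : ℂ)⁻¹ = (genFactorial μ n : ℂ)⁻¹ := by
  rw [genFactorial_succ hμ, Complex.ofReal_mul, mul_inv,
    mul_inv_cancel_left₀ (Complex.ofReal_ne_zero.2 (dunklCoeff_pos hμ n.succ_pos).ne')]

theorem dunklSeries_transformSeries (hμ : -(1 / 2 : ℝ) < μ) {a : ℝ} (ha : 0 < a) (ω : ℂ)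
    (p : ℂ[X]) :
    dunklSeries μ (transformSeries hμ ha ω p) =
      ω • transformSeries hμ ha ω (Polynomial.X * p) := by
  ext n
  rw [coeff_dunklSeries, coeff_transformSeries, ← mul_assoc, ← mul_assoc,
    dunklCoeff_mul_inv_genFactorial hμ, PowerSeries.coeff_smul, coeff_transformSeries, pow_succ,
    pow_succ, mul_assoc (Polynomial.X ^ n), smul_eq_mul]
  ring

theorem transformSeries_dunklOp (hμ : -(1 / 2 : ℝ) < μ) {a : ℝ} (ha : 0 < a) (ω : ℂ) (p : ℂ[X]) :
    transformSeries hμ ha ω (dunklOp μ p) =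
      (2 * a : ℂ) • transformSeries hμ ha ω (Polynomial.X * p) -
        ω • (PowerSeries.X * transformSeries hμ ha ω p) := by
  ext n
  have hparts := gaussIntegral_dunklOp_mul_add hμ ha (Polynomial.X ^ n) p
  rw [mul_left_comm] at hparts
  simp only [map_sub, PowerSeries.coeff_smul, coeff_transformSeries, smul_eq_mul]
  cases n with
  | zero =>
    rw [pow_zero, dunklOp_one, zero_mul, map_zero, zero_add] at hparts
    rw [pow_zero Polynomial.X, hparts, PowerSeries.coeff_zero_X_mul]
    ring
  | succ n =>
    have hD : dunklOp μ (Polynomial.X ^ (n + 1)) =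
        (dunklCoeff μ (n + 1) : ℂ) • Polynomial.X ^ n := by
      rw [← Polynomial.monomial_one_right_eq_X_pow, dunklOp_monomial, mul_one,
        ← Polynomial.monomial_one_right_eq_X_pow, Polynomial.smul_monomial, smul_eq_mul, mul_one,
        Nat.add_sub_cancel]
    rw [hD, smul_mul_assoc, map_smul, smul_eq_mul] at hparts
    rw [PowerSeries.coeff_succ_X_mul, coeff_transformSeries,
      ← dunklCoeff_mul_inv_genFactorial hμ n, pow_succ ω]
    linear_combination (genFactorial μ (n + 1) : ℂ)⁻¹ * ω ^ n * ω * hparts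

theorem transformSeries_one (hμ : -(1 / 2 : ℝ) < μ) {ω : ℂ} (hω : ω ^ 2 = -1) :
    transformSeries hμ one_half_pos ω 1 = (gaussMoment μ (1 / 2) 0 : ℂ) • gaussSeries := by
  have hD : dunklSeries μ (transformSeries hμ one_half_pos ω 1) =
      -PowerSeries.X * transformSeries hμ one_half_pos ω 1 := by
    have h := transformSeries_dunklOp hμ one_half_pos ω 1
    rw [dunklOp_one, map_zero, show (2 * ((1 / 2 : ℝ) : ℂ)) = 1 by norm_num, one_smul, eq_comm,
      sub_eq_zero] at h
    rw [dunklSeries_transformSeries, h, smul_smul, ← sq, hω, neg_one_smul, neg_mul]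
  refine eq_of_dunklSeries_eq_mul hμ hD ?_ ?_
  · rw [map_smul, dunklSeries_gaussSeries, mul_smul_comm]
  · have h := gaussIntegral_monomial hμ (one_half_pos (α := ℝ)) 0 1
    rw [Polynomial.monomial_zero_one, one_mul] at h
    rw [← PowerSeries.coeff_zero_eq_constantCoeff_apply,
      ← PowerSeries.coeff_zero_eq_constantCoeff_apply, coeff_transformSeries,
      PowerSeries.coeff_smul, pow_zero, pow_zero, one_mul, h, genFactorial_zero hμ]
    simp [gaussSeries]

theorem transformSeries_hermitePoly (hμ : -(1 / 2 : ℝ) < μ) {ω : ℂ} (hω : ω ^ 2 = -1) (n : ℕ) :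
    transformSeries hμ one_half_pos ω (hermitePoly μ n) =
      (ω ^ n * gaussMoment μ (1 / 2) 0 : ℂ) • ((hermitePoly μ n : ℂ⟦X⟧) * gaussSeries) := by
  induction n with
  | zero =>
    rw [hermitePoly, transformSeries_one hμ hω, pow_zero, one_mul, Polynomial.coe_one, one_mul]
  | succ n ih =>
    set S := transformSeries hμ one_half_pos ω
    set H := hermitePoly μ n
    have hcreate : S (2 * Polynomial.X * H - dunklOp μ H) =
        ω • (PowerSeries.X * S H - dunklSeries μ (S H)) := by
      have htwo : 2 * Polynomial.X * H = (2 : ℂ) • (Polynomial.X * H) := by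
        rw [Polynomial.smul_eq_C_mul, map_ofNat, mul_assoc]
      rw [htwo, map_sub, map_smul, transformSeries_dunklOp, dunklSeries_transformSeries,
        smul_sub, smul_smul, ← sq, hω, show (2 * ((1 / 2 : ℝ) : ℂ)) = 1 by norm_num]
      module
    rw [hermitePoly, hcreate, ih, map_smul, dunklSeries_coe_mul_gaussSeries, mul_smul_comm,
      ← smul_sub, smul_smul, ← mul_assoc, ← pow_succ']
    congr 1
    have htwo : ((2 : ℂ[X]) : ℂ⟦X⟧) = 2 := map_ofNat Polynomial.coeToPowerSeries.ringHom 2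
    rw [Polynomial.coe_sub, Polynomial.coe_mul, Polynomial.coe_mul, htwo, Polynomial.coe_X]
    ring

/-- The common form of the transform, `ω = -i`, and of its inverse, `ω = i`. -/
def transform (μ : ℝ) (ω : ℂ) (f : ℝ → ℂ) (x : ℝ) : ℂ :=
  (((2 : ℝ) ^ (μ + 1 / 2) * Real.Gamma (μ + 1 / 2) : ℝ) : ℂ)⁻¹ *
    ∫ t, genExp μ (ω * x * t) * f t ∂(weightMeasure μ)

theorem fourierIntegralW_eq_transform (μ : ℝ) :
    fourierIntegralW μ = transform μ (-Complex.I) := by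
  ext f x
  simp only [fourierIntegralW, transform, integral_weightMeasure, Complex.real_smul, mul_comm]

theorem fourierIntegralInvW_eq_transform (μ : ℝ) :
    fourierIntegralInvW μ = transform μ Complex.I := by
  ext f x
  simp only [fourierIntegralInvW, transform, integral_weightMeasure, Complex.real_smul, mul_comm]

theorem norm_genExp_mul_ofReal_le (hμ : -(1 / 2 : ℝ) < μ) (z : ℂ) (t : ℝ) :
    ‖genExp μ (z * t)‖ ≤ Real.exp (dunklRate μ * ‖z‖ * |t|) := by
  simpa [mul_assoc] using norm_genExp_le hμ (z * t)

theorem integrable_genExp_mul_polyGauss (hμ : -(1 / 2 : ℝ) < μ) {a : ℝ} (ha : 0 < a) (z : ℂ)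
    (p : ℂ[X]) :
    Integrable (fun t : ℝ => genExp μ (z * t) * polyGauss a p t) (weightMeasure μ) := by
  have hcont := (continuous_genExp hμ).comp (by fun_prop : Continuous fun t : ℝ => z * (t : ℂ))
  refine (integrable_exp_abs_smul_polyGauss hμ ha (dunklRate μ * ‖z‖) p).mono
    (hcont.mul (continuous_polyGauss a p)).aestronglyMeasurable
    (Filter.Eventually.of_forall fun t => ?_)
  rw [norm_mul, norm_smul, Real.norm_of_nonneg (Real.exp_pos _).le]
  gcongr
  exact norm_genExp_mul_ofReal_le hμ z t

theorem integrable_genExp_mul_weight (hμ : -(1 / 2 : ℝ) < μ) {a : ℝ} (ha : 0 < a) {f : ℝ → ℂ}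
    (hf : f ∈ gaussSpan a) (z : ℂ) :
    Integrable fun t : ℝ => genExp μ (z * t) * f t * ((|t| ^ (2 * μ) : ℝ) : ℂ) := by
  rw [gaussSpan_eq_range] at hf
  obtain ⟨p, rfl⟩ := hf
  simpa only [Complex.real_smul, mul_comm] using
    integrable_weightMeasure_iff.1 (integrable_genExp_mul_polyGauss hμ ha z p)

theorem hasSum_coeff_coe_mul_pow (p : ℂ[X]) (z : ℂ) :
    HasSum (fun n => PowerSeries.coeff n (p : ℂ⟦X⟧) * z ^ n) (p.eval z) := by
  rw [Polynomial.eval_eq_sum, Polynomial.sum]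
  simp only [Polynomial.coeff_coe]
  exact hasSum_sum_of_ne_finset_zero fun n hn => by
    rw [Polynomial.notMem_support_iff.1 hn, zero_mul]

theorem hasSum_transformSeries (hμ : -(1 / 2 : ℝ) < μ) {a : ℝ} (ha : 0 < a) (ω : ℂ) (p : ℂ[X])
    (x : ℝ) :
    HasSum (fun n => PowerSeries.coeff n (transformSeries hμ ha ω p) * (x : ℂ) ^ n)
      (∫ t, genExp μ (ω * x * t) * polyGauss a p t ∂(weightMeasure μ)) := by
  refine (hasSum_mul_integral_pow_mul (norm_inv_genFactorial_le hμ) (hasSum_genExp hμ)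
    (continuous_polyGauss a p).aestronglyMeasurable
    (integrable_exp_abs_smul_polyGauss hμ ha _ p)).congr_fun fun n => ?_
  have hmoment : gaussIntegral hμ ha (Polynomial.X ^ n * p) =
      ∫ t, (t : ℂ) ^ n * polyGauss a p t ∂(weightMeasure μ) := by
    simp only [gaussIntegral_apply, polyGauss_apply, Polynomial.eval_mul, Polynomial.eval_pow,
      Polynomial.eval_X, mul_left_comm]
  rw [coeff_transformSeries, hmoment]
  ring

theorem integral_genExp_mul_polyGauss_hermitePoly (hμ : -(1 / 2 : ℝ) < μ) {ω : ℂ}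
    (hω : ω ^ 2 = -1) (n : ℕ) (x : ℝ) :
    ∫ t, genExp μ (ω * x * t) * polyGauss (1 / 2) (hermitePoly μ n) t ∂(weightMeasure μ) =
      ω ^ n * gaussMoment μ (1 / 2) 0 * polyGauss (1 / 2) (hermitePoly μ n) x := by
  have hseries := hasSum_transformSeries hμ one_half_pos ω (hermitePoly μ n) x
  simp only [transformSeries_hermitePoly hμ hω, PowerSeries.coeff_smul, smul_eq_mul, mul_assoc]
    at hseries
  have hprod := hasSum_coeff_mul_mul_pow (hasSum_coeff_coe_mul_pow (hermitePoly μ n) x)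
    (hasSum_coeff_gaussSeries_mul_pow x)
  rw [polyGauss_apply, mul_comm (Real.exp _ : ℂ), mul_assoc]
  simpa only [mul_assoc] using hseries.unique ((hprod.mul_left _).mul_left _)

theorem transform_hermiteFun (hμ : -(1 / 2 : ℝ) < μ) {ω : ℂ} (hω : ω ^ 2 = -1) (n : ℕ) (x : ℝ) :
    transform μ ω (hermiteFun μ n) x = ω ^ n * hermiteFun μ n x := by
  have hM : gaussMoment μ (1 / 2) 0 = 2 ^ (μ + 1 / 2) * Real.Gamma (μ + 1 / 2) := by
    rw [gaussMoment_zero hμ one_half_pos, one_div, Real.inv_rpow zero_le_two,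
      Real.rpow_neg zero_le_two, inv_inv]
  have hM0 : (gaussMoment μ (1 / 2) 0 : ℂ) ≠ 0 := by
    have := gamma_half_pos hμ
    rw [hM]
    exact Complex.ofReal_ne_zero.2 (by positivity)
  rw [hermiteFun_eq_polyGauss hμ, normHermitePoly, map_smul, transform, ← hM]
  simp only [Pi.smul_apply, smul_eq_mul, mul_left_comm _ (hermiteConst μ n : ℂ)]
  rw [integral_const_mul, integral_genExp_mul_polyGauss_hermitePoly hμ hω]
  field_simp

/-! ### Extension to `L²` -/

theorem ae_eq_of_dense_span {𝕜 E F α : Type*} [NormedField 𝕜] [NormedAddCommGroup E]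
    [NormedSpace 𝕜 E] [NormedAddCommGroup F] [NormedSpace 𝕜 F] [MeasurableSpace α] {ν : Measure α}
    {p : ℝ≥0∞} [Fact (1 ≤ p)] {H : E →L[𝕜] Lp F p ν} {T : α → E →L[𝕜] F} {s : Set E}
    (hs : (Submodule.span 𝕜 s).topologicalClosure = ⊤)
    (h : ∀ f ∈ s, H f =ᵐ[ν] fun x => T x f) (f : E) : H f =ᵐ[ν] fun x => T x f := by
  have hspan : ∀ g ∈ Submodule.span 𝕜 s, H g =ᵐ[ν] fun x => T x g := fun g hg => by
    induction hg using Submodule.span_induction with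
    | mem g hg => exact h g hg
    | zero =>
      simp only [map_zero]
      exact Lp.coeFn_zero F p ν
    | add g g' _ _ hg hg' =>
      simp only [map_add]
      exact (Lp.coeFn_add _ _).trans (hg.add hg')
    | smul c g _ hg =>
      simp only [map_smul]
      exact (Lp.coeFn_smul c _).trans (hg.const_smul c)
  have hf : f ∈ closure (Submodule.span 𝕜 s : Set E) := by
    rw [← Submodule.topologicalClosure_coe, hs]
    trivial
  obtain ⟨u, hu, hlim⟩ := mem_closure_iff_seq_limit.1 hf
  obtain ⟨k, hk, hae⟩ := (tendstoInMeasure_of_tendsto_Lp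
    ((H.continuous.tendsto f).comp hlim)).exists_seq_tendsto_ae
  filter_upwards [hae, ae_all_iff.2 fun n => hspan (u n) (hu n)] with x hx hux
  refine tendsto_nhds_unique hx ?_
  simp only [Function.comp_apply, hux]
  exact ((T x).continuous.tendsto f).comp (hlim.comp hk.tendsto_atTop)

theorem memLp_top_gaussian {ε : ℝ} (hε : 0 ≤ ε) (ν : Measure ℝ) :
    MemLp (fun t : ℝ => (Real.exp (-(ε * t ^ 2)) : ℂ)) ∞ ν := by
  refine memLp_top_of_bound (by fun_prop) 1 (Filter.Eventually.of_forall fun t => ?_)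
  rw [Complex.norm_real, Real.norm_of_nonneg (Real.exp_pos _).le, Real.exp_le_one_iff, neg_nonpos]
  positivity

/-- Multiplication by `exp (-ε t²)`, as an operator on `L2w μ`. -/
def gaussMul (μ : ℝ) {ε : ℝ} (hε : 0 ≤ ε) : L2w μ →L[ℂ] L2w μ :=
  (ContinuousLinearMap.mul ℂ ℂ).holderL (weightMeasure μ) ∞ 2 2
    ((memLp_top_gaussian hε (weightMeasure μ)).toLp _)

theorem coeFn_gaussMul {ε : ℝ} (hε : 0 ≤ ε) (f : L2w μ) :
    gaussMul μ hε f =ᵐ[weightMeasure μ] fun t => Real.exp (-(ε * t ^ 2)) * f t := by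
  refine ((ContinuousLinearMap.mul ℂ ℂ).coeFn_holder _ f).trans ?_
  filter_upwards [(memLp_top_gaussian hε (weightMeasure μ)).coeFn_toLp] with t ht
  rw [ht, ContinuousLinearMap.mul_apply']

theorem polyGauss_add (a ε : ℝ) (p : ℂ[X]) (t : ℝ) :
    polyGauss (a + ε) p t = Real.exp (-(ε * t ^ 2)) * polyGauss a p t := by
  rw [polyGauss_apply, polyGauss_apply, ← mul_assoc, ← Complex.ofReal_mul, ← Real.exp_add]
  ring_nf

theorem gaussMul_polyGaussLp (hμ : -(1 / 2 : ℝ) < μ) {a ε : ℝ} (ha : 0 < a) (hε : 0 ≤ ε)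
    (p : ℂ[X]) :
    gaussMul μ hε (polyGaussLp hμ ha p) = polyGaussLp hμ (add_pos_of_pos_of_nonneg ha hε) p := by
  refine Lp.ext ?_
  filter_upwards [coeFn_gaussMul hε (polyGaussLp hμ ha p), coeFn_polyGaussLp hμ ha p,
    coeFn_polyGaussLp hμ (add_pos_of_pos_of_nonneg ha hε) p] with t hmul hp hadd
  rw [hmul, hp, hadd, polyGauss_add]

theorem memLp_genExp_mul_gaussian (hμ : -(1 / 2 : ℝ) < μ) {ε : ℝ} (hε : 0 < ε) (z : ℂ) :
    MemLp (fun t : ℝ => genExp μ (z * t) * Real.exp (-(ε * t ^ 2))) 2 (weightMeasure μ) := by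
  have hcont := (continuous_genExp hμ).comp (by fun_prop : Continuous fun t : ℝ => z * (t : ℂ))
  refine (memLp_exp_abs_mul_gaussian hμ hε (dunklRate μ * ‖z‖)).mono'
    (hcont.mul (by fun_prop)).aestronglyMeasurable (Filter.Eventually.of_forall fun t => ?_)
  rw [norm_mul, Complex.norm_real, Real.norm_of_nonneg (Real.exp_pos _).le]
  gcongr
  exact norm_genExp_mul_ofReal_le hμ z t

/-- The value at `x` of the transform of `exp (-ε t²) f(t)`. Unlike for `f` itself, the integral
converges absolutely for all `f` in `L2w μ`, and is continuous in `f`. -/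
def transformGaussMul (hμ : -(1 / 2 : ℝ) < μ) {ε : ℝ} (hε : 0 < ε) (ω : ℂ) (x : ℝ) :
    L2w μ →L[ℂ] ℂ :=
  (((2 : ℝ) ^ (μ + 1 / 2) * Real.Gamma (μ + 1 / 2) : ℝ) : ℂ)⁻¹ •
    (ContinuousLinearMap.mul ℂ ℂ).lpPairing (weightMeasure μ) 2 2
      ((memLp_genExp_mul_gaussian hμ hε (ω * x)).toLp _)

theorem transformGaussMul_polyGaussLp (hμ : -(1 / 2 : ℝ) < μ) {a ε : ℝ} (ha : 0 < a) (hε : 0 < ε)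
    (ω : ℂ) (p : ℂ[X]) (x : ℝ) :
    transformGaussMul hμ hε ω x (polyGaussLp hμ ha p) = transform μ ω (polyGauss (a + ε) p) x := by
  rw [transformGaussMul, transform, smul_apply,
    ContinuousLinearMap.lpPairing_eq_integral, smul_eq_mul]
  congr 1
  refine integral_congr_ae ?_
  filter_upwards [(memLp_genExp_mul_gaussian hμ hε (ω * x)).coeFn_toLp,
    coeFn_polyGaussLp hμ ha p] with t hker hp
  rw [hker, hp, ContinuousLinearMap.mul_apply', polyGauss_add, mul_assoc]

theorem extendsOn_iff (hμ : -(1 / 2 : ℝ) < μ) {a : ℝ} (ha : 0 < a) {T : (ℝ → ℂ) → ℝ → ℂ}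
    {G : L2w μ → L2w μ} :
    ExtendsOn μ a T G ↔
      ∀ p, G (polyGaussLp hμ ha p) =ᵐ[weightMeasure μ] T (polyGauss a p) := by
  simp only [ExtendsOn, gaussSpan_eq_range, LinearMap.mem_range, forall_exists_index,
    forall_apply_eq_imp_iff]
  exact forall_congr' fun p => ⟨fun ⟨_, h⟩ => h, fun h => ⟨memLp_polyGauss hμ ha p, h⟩⟩

theorem extendsOn_transform_of_span (hμ : -(1 / 2 : ℝ) < μ) {a b : ℝ} (ha : 0 < a) (hb : 0 < b)
    {ω : ℂ} {ι : Type*} {P : ι → ℂ[X]} (hP : Submodule.span ℂ (Set.range P) = ⊤)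
    {G : L2w μ →L[ℂ] L2w μ}
    (hG : ∀ i, G (polyGaussLp hμ ha (P i)) =ᵐ[weightMeasure μ] transform μ ω (polyGauss a (P i))) :
    ExtendsOn μ b (transform μ ω) G := by
  obtain ⟨ε, hε, hεab⟩ := exists_between (lt_min ha hb)
  obtain ⟨hεa, hεb⟩ := lt_min_iff.1 hεab
  obtain ⟨a, rfl⟩ : ∃ a', a = a' + ε := ⟨a - ε, by ring⟩
  obtain ⟨b, rfl⟩ : ∃ b', b = b' + ε := ⟨b - ε, by ring⟩
  rw [lt_add_iff_pos_left] at hεa hεb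
  rw [extendsOn_iff hμ hb]
  intro p
  have hdense := ae_eq_of_dense_span (H := G ∘L gaussMul μ hε.le)
    (T := transformGaussMul hμ hε ω)
    (topologicalClosure_span_range_polyGaussLp hμ hεa hP) (by
      rintro _ ⟨i, rfl⟩
      simp only [ContinuousLinearMap.comp_apply, gaussMul_polyGaussLp hμ hεa,
        transformGaussMul_polyGaussLp hμ hεa]
      exact hG i)
  simpa only [ContinuousLinearMap.comp_apply, gaussMul_polyGaussLp hμ hεb,
    transformGaussMul_polyGaussLp hμ hεb] using hdense (polyGaussLp hμ hεb p)

theorem ExtendsOn.unique (hμ : -(1 / 2 : ℝ) < μ) {a : ℝ} (ha : 0 < a) {T : (ℝ → ℂ) → ℝ → ℂ}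
    {G G' : L2w μ →L[ℂ] L2w μ} (hG : ExtendsOn μ a T G) (hG' : ExtendsOn μ a T G') : G = G' := by
  rw [extendsOn_iff hμ ha] at hG hG'
  have hspan : Submodule.span ℂ (Set.range fun p : ℂ[X] => p) = ⊤ := by
    rw [Set.range_id', Submodule.span_univ]
  refine ContinuousLinearMap.ext_on ((Submodule.dense_iff_topologicalClosure_eq_top).2
    (topologicalClosure_span_range_polyGaussLp hμ ha hspan)) ?_
  rintro _ ⟨p, rfl⟩
  exact Lp.ext ((hG p).trans (hG' p).symm)

/-! ### Diagonal operators -/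

section Diagonal

variable {ι 𝕜 E : Type*} [RCLike 𝕜] [NormedAddCommGroup E] [InnerProductSpace 𝕜 E]

theorem exists_linearIsometryEquiv_diagonal [CompleteSpace E] (b : HilbertBasis ι 𝕜 E) {c : ι → 𝕜}
    (hc : ∀ i, ‖c i‖ = 1) : ∃ F : E ≃ₗᵢ[𝕜] E, ∀ i, F (b i) = c i • b i := by
  have hc0 : ∀ i, c i ≠ 0 := fun i => norm_ne_zero_iff.1 (by simp [hc i])
  have horth : Orthonormal 𝕜 fun i => c i • b i :=
    ⟨fun i => by rw [norm_smul, hc, b.orthonormal.1, one_mul], fun i j hij => by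
      simp only [inner_smul_left, inner_smul_right, b.orthonormal.2 hij, mul_zero]⟩
  have hdense : (Submodule.span 𝕜 (Set.range fun i => c i • b i)).topologicalClosure = ⊤ := by
    rw [eq_top_iff, ← b.dense_span]
    refine Submodule.topologicalClosure_mono (Submodule.span_le.2 ?_)
    rintro _ ⟨i, rfl⟩
    rw [SetLike.mem_coe, ← inv_smul_smul₀ (hc0 i) (b i)]
    exact Submodule.smul_mem _ _ (Submodule.subset_span ⟨i, rfl⟩)
  classical
  refine ⟨b.repr.trans (HilbertBasis.mk horth hdense.ge).repr.symm, fun i => ?_⟩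
  rw [LinearIsometryEquiv.trans_apply, b.repr_self, HilbertBasis.repr_symm_single,
    HilbertBasis.coe_mk]

theorem hasEigenvector_of_diagonal (b : HilbertBasis ι 𝕜 E) {c : ι → 𝕜} {F : E ≃ₗᵢ[𝕜] E}
    (hF : ∀ i, F (b i) = c i • b i) (i : ι) :
    Module.End.HasEigenvector (F.toLinearEquiv : E →ₗ[𝕜] E) (c i) (b i) :=
  Module.End.hasEigenvector_iff.2 ⟨Module.End.mem_eigenspace_iff.2 (hF i), b.orthonormal.ne_zero i⟩

theorem inner_apply_of_diagonal (b : HilbertBasis ι 𝕜 E) {c : ι → 𝕜} {F : E ≃ₗᵢ[𝕜] E}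
    (hF : ∀ i, F (b i) = c i • b i) (i : ι) (v : E) :
    inner 𝕜 (b i) (F v) = c i * inner 𝕜 (b i) v := by
  have hc : ‖c i‖ = 1 := by
    have h := congrArg norm (hF i)
    rwa [F.norm_map, norm_smul, b.orthonormal.1, mul_one, eq_comm] at h
  have hF_inner : inner 𝕜 (F (b i)) (F v) = inner 𝕜 (b i) v := F.inner_map_map _ _
  rw [← hF_inner, hF, inner_smul_left, ← mul_assoc, RCLike.mul_conj, hc]
  simp

theorem hasEigenvalue_iff_of_diagonal (b : HilbertBasis ι 𝕜 E) {c : ι → 𝕜} {F : E ≃ₗᵢ[𝕜] E}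
    (hF : ∀ i, F (b i) = c i • b i) {z : 𝕜} :
    Module.End.HasEigenvalue (F.toLinearEquiv : E →ₗ[𝕜] E) z ↔ ∃ i, c i = z := by
  constructor
  · intro hz
    obtain ⟨v, hv⟩ := hz.exists_hasEigenvector
    by_contra! hne
    refine hv.2 (b.repr.map_eq_zero_iff.1 ?_)
    ext i
    have hcoord := inner_apply_of_diagonal b hF i v
    rw [show F v = z • v from hv.apply_eq_smul, inner_smul_right] at hcoord
    rw [b.repr_apply_apply, lp.coeFn_zero, Pi.zero_apply]
    by_contra h0
    exact hne i (mul_right_cancel₀ h0 hcoord).symm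
  · rintro ⟨i, rfl⟩
    exact Module.End.hasEigenvalue_of_hasEigenvector (hasEigenvector_of_diagonal b hF i)

end Diagonal

theorem exists_neg_I_pow_eq_iff (z : ℂ) :
    (∃ n : ℕ, (-Complex.I) ^ n = z) ↔
      z = 1 ∨ z = -1 ∨ z = Complex.I ∨ z = -Complex.I := by
  constructor
  · rintro ⟨n, rfl⟩
    induction n with
    | zero => simp
    | succ n ih => rcases ih with h | h | h | h <;> simp [pow_succ, h]
  · rintro (rfl | rfl | rfl | rfl)
    exacts [⟨0, by simp⟩, ⟨2, by simp⟩, ⟨3, by simp [pow_succ]⟩, ⟨1, by simp⟩]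

/-- The generalized Hermite functions, as a Hilbert basis of `L2w μ`. -/
def hermiteBasis (hμ : -(1 / 2 : ℝ) < μ) : HilbertBasis ℕ ℂ (L2w μ) :=
  HilbertBasis.mk (orthonormal_hermiteFun hμ) (topologicalClosure_span_hermiteFun hμ).ge

theorem hermiteBasis_apply (hμ : -(1 / 2 : ℝ) < μ) (n : ℕ) :
    hermiteBasis hμ n = (memLp_hermiteFun hμ n).toLp (hermiteFun μ n) := by
  rw [hermiteBasis, HilbertBasis.coe_mk]

theorem extendsOn_transform_of_diagonal (hμ : -(1 / 2 : ℝ) < μ) {ω : ℂ} (hω : ω ^ 2 = -1)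
    {F : L2w μ ≃ₗᵢ[ℂ] L2w μ} (hF : ∀ n, F (hermiteBasis hμ n) = ω ^ n • hermiteBasis hμ n) {a : ℝ}
    (ha : 0 < a) : ExtendsOn μ a (transform μ ω) F := by
  refine extendsOn_transform_of_span hμ one_half_pos ha (span_range_normHermitePoly hμ)
    (G := F.toContinuousLinearEquiv.toContinuousLinearMap) fun n => ?_
  have hn : F (polyGaussLp hμ one_half_pos (normHermitePoly μ n)) =
      ω ^ n • polyGaussLp hμ one_half_pos (normHermitePoly μ n) := by
    rw [← toLp_hermiteFun hμ, ← hermiteBasis_apply, hF]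
  filter_upwards [Lp.coeFn_smul (ω ^ n) (polyGaussLp hμ one_half_pos (normHermitePoly μ n)),
    coeFn_polyGaussLp hμ one_half_pos (normHermitePoly μ n)] with x hsmul hx
  rw [← hermiteFun_eq_polyGauss hμ] at hx ⊢
  rw [transform_hermiteFun hμ hω, ← hx, ← smul_eq_mul, ← Pi.smul_apply, ← hsmul, ← hn]
  rfl

end

theorem theorem3p6 (μ : ℝ) (hμ : -(1 / 2 : ℝ) < μ) :
    -- the integrals converge
    (∀ a : ℝ, 0 < a → ∀ f ∈ gaussSpan a, ∀ x : ℝ,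
      Integrable (fun t : ℝ =>
        genExp μ (-Complex.I * x * t) * f t * ((|t| ^ (2 * μ) : ℝ) : ℂ)) ∧
      Integrable (fun t : ℝ =>
        genExp μ (Complex.I * x * t) * f t * ((|t| ^ (2 * μ) : ℝ) : ℂ))) ∧
    ∃ F : L2w μ ≃ₗᵢ[ℂ] L2w μ,
      -- `F` extends the integral transform, and is the only bounded operator which does
      (∀ a : ℝ, 0 < a → ExtendsOn μ a (fourierIntegralW μ) F) ∧
      (∀ a : ℝ, 0 < a → ∀ G : L2w μ →L[ℂ] L2w μ, ExtendsOn μ a (fourierIntegralW μ) G →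
        ∀ f : L2w μ, G f = F f) ∧
      -- the eigenvalues
      (∀ z : ℂ, Module.End.HasEigenvalue (F.toLinearEquiv : L2w μ →ₗ[ℂ] L2w μ) z ↔
        z = 1 ∨ z = -1 ∨ z = Complex.I ∨ z = -Complex.I) ∧
      -- the generalized Hermite functions are a complete orthonormal set of eigenvectors
      (∃ hφ : ∀ n : ℕ, MemLp (hermiteFun μ n) 2 (weightMeasure μ),
        Orthonormal ℂ (fun n : ℕ => (hφ n).toLp (hermiteFun μ n)) ∧
        (Submodule.span ℂ
          (Set.range fun n : ℕ => (hφ n).toLp (hermiteFun μ n))).topologicalClosure = ⊤ ∧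
        ∀ n : ℕ, Module.End.HasEigenvector (F.toLinearEquiv : L2w μ →ₗ[ℂ] L2w μ)
          ((-Complex.I) ^ n) ((hφ n).toLp (hermiteFun μ n))) ∧
      -- the inverse transform
      (∀ a : ℝ, 0 < a → ExtendsOn μ a (fourierIntegralInvW μ) F.symm) := by
  have hI : (-Complex.I) ^ 2 = -1 := by simp
  obtain ⟨F, hF⟩ := exists_linearIsometryEquiv_diagonal (hermiteBasis hμ)
    (c := fun n => (-Complex.I) ^ n) fun n => by simp
  have hFsymm : ∀ n, F.symm (hermiteBasis hμ n) = Complex.I ^ n • hermiteBasis hμ n := fun n => by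
    rw [LinearIsometryEquiv.symm_apply_eq, map_smul, hF, smul_smul, ← mul_pow]
    simp
  rw [fourierIntegralW_eq_transform, fourierIntegralInvW_eq_transform]
  have hextends : ∀ a : ℝ, 0 < a → ExtendsOn μ a (transform μ (-Complex.I)) F :=
    fun a ha => extendsOn_transform_of_diagonal hμ hI hF ha
  refine ⟨fun a ha f hf x => ⟨integrable_genExp_mul_weight hμ ha hf _,
    integrable_genExp_mul_weight hμ ha hf _⟩, F, hextends, fun a ha G hG f => ?_, fun z => ?_,
    ⟨memLp_hermiteFun hμ, orthonormal_hermiteFun hμ, topologicalClosure_span_hermiteFun hμ,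
      fun n => ?_⟩, fun a ha => extendsOn_transform_of_diagonal hμ Complex.I_sq hFsymm ha⟩
  · rw [hG.unique hμ ha (G' := F.toContinuousLinearEquiv.toContinuousLinearMap) (hextends a ha)]
    rfl
  · rw [hasEigenvalue_iff_of_diagonal _ hF, exists_neg_I_pow_eq_iff]
  · rw [← hermiteBasis_apply]
    exact hasEigenvector_of_diagonal _ hF n
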